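/- Let $\mathfrak H$ be a complex separable Hilbert space with inner product $\langle\cdot,\cdot\rangle$ (linear in the first slot), equipped with a complex conjugation $h\mapsto\bar h$ (an antiunitary involution; i.e. $\mathfrak H$ is the complexification of a real Hilbert space). Let $Z=\{Z(h):h\in\mathfrak H\}$ be a complex isonormal Gaussian process on a probability space $(\Omega,\mathcal F,P)$: a centred jointly Gaussian family of complex random variables with $E[Z(g)\overline{Z(h)}]=\langle g,h\rangle$ and $E[Z(g)Z(h)]=0$; assume that $\mathcal F=\sigma(Z)$ up to null sets. Let $\mathfrak H^{\odot k}$ be the symmetric Hilbert tensor power and $$J_{m,n}(z,\rho)=\sum_{k=0}^{m\wedge n}(-1)^k k!\binom mk\binom nk z^{m-k}\bar z^{\,n-k}\rho^k$$ the complex Hermite polynomials. The complex Wiener–Itô integral $I_{m,n}:\mathfrak H^{\odot m}\otimes\mathfrak H^{\odot n}\to L^2(\Omega)$ (Hilbert tensor product) is the unique bounded linear operator with $I_{m,n}(h^{\otimes m}\otimes\bar h^{\otimes n})=J_{m,n}(Z(h),\|h\|^2)$ for all $h\in\mathfrak H$. Let $\mathcal S$ be the set of random variables $F=f(Z(\varphi_1),\dots,Z(\varphi_k))$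 with $\varphi_i\in\mathfrak H$ and $f:\mathbb C^k\to\mathbb C$ smooth (in the real sense), $f$ and all its derivatives having polynomial growth. For such $F$ put, with Wirtinger derivatives, $$DF=\sum_i\frac{\partial f}{\partial z_i}(Z(\varphi_1),\dots,Z(\varphi_k))\,\varphi_i,\qquad \bar DF=\sum_i\frac{\partial f}{\partial\bar z_i}(Z(\varphi_1),\dots,Z(\varphi_k))\,\bar\varphi_i .$$ Denote also by $D,\bar D$ the closures of these operators from $L^2(\Omega)$ to $L^2(\Omega;\mathfrak H)$, let $\delta,\bar\delta$ be the Hilbert space adjoints of $D,\bar D$, and let $L=\delta D$, $\bar L=\bar\delta\bar D$ with their natural domains. **Proposition.** The operators $I_{m,n}$ exist and are unique. For all $m,n\ge 0$ and all $f\in\mathfrak H^{\odot m}\otimes\mathfrak H^{\odot n}$, the random variable $I_{m,n}(f)$ belongs to the domains of $D$, $\bar D$, $L$ and $\bar L$, and $$D_\cdot I_{m,n}(f)=m\,I_{m-1,n}(f),\qquad \bar D_\cdot I_{m,n}(f)=n\,I_{m,n-1}(f),$$ $$L\,I_{m,n}(f)=m\,I_{m,n}(f),\qquad \bar L\,I_{m,n}(f)=n\,I_{m,n}(f).$$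 Here, for $m\ge1$, $I_{m-1,n}(f)$ denotes the $\mathfrak H$-valued random variable obtained by integrating all variables of $f$ except one of the first $m$; that is, for every $g\in\mathfrak H$, $\langle I_{m-1,n}(f),g\rangle=I_{m-1,n}(f_g)$ a.s., where $f\mapsto f_g$ is the bounded linear operator $\mathfrak H^{\odot m}\otimes\mathfrak H^{\odot n}\to\mathfrak H^{\odot(m-1)}\otimes\mathfrak H^{\odot n}$ that pairs one of the first $m$ variables with $g$, so that $h^{\otimes m}\otimes k^{\otimes n}\mapsto\langle h,g\rangle\,h^{\otimes(m-1)}\otimes k^{\otimes n}$. For $n\ge 1$, $I_{m,n-1}(f)$ is defined likewise by pairing one of the last $n$ variables with $g$. For $m=0$ (respectively $n=0$) the right-hand side of the first (respectively second) identity is $0$. -/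

import Mathlib

open MeasureTheory ProbabilityTheory TensorProduct UniformSpace Topology
open scoped ENNReal ComplexConjugate InnerProductSpace

noncomputable section

universe u v

/-! ### Hilbert tensor products -/

section HilbertTensor

variable (E F : Type*) [NormedAddCommGroup E] [InnerProductSpace ℂ E]
  [NormedAddCommGroup F] [InnerProductSpace ℂ F]

/-- The Hilbert space tensor product: the completion of the algebraic tensor product for the
inner product with `⟪e ⊗ f, e' ⊗ f'⟫ = ⟪e, e'⟫ * ⟪f, f'⟫`. -/
abbrev HTensor : Type _ := Completion (E ⊗[ℂ] F)

variable {E F}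

/-- The elementary tensor `e ⊗ f` in the Hilbert tensor product. -/
def htmul (e : E) (f : F) : HTensor E F := ((e ⊗ₜ[ℂ] f : E ⊗[ℂ] F) : Completion (E ⊗[ℂ] F))

/-- `f ↦ e ⊗ f` as a bounded operator. -/
def htmulL (e : E) : F →L[ℂ] HTensor E F := Completion.toComplL ∘L TensorProduct.mkL ℂ E F e

lemma htmulL_apply (e : E) (f : F) : htmulL e f = htmul e f := rfl

/-- The bounded operator `A ⊗ B` on Hilbert tensor products. -/
def hmap {E' F' : Type*} [NormedAddCommGroup E'] [InnerProductSpace ℂ E']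
    [NormedAddCommGroup F'] [InnerProductSpace ℂ F'] (A : E →L[ℂ] E') (B : F →L[ℂ] F') :
    HTensor E F →L[ℂ] HTensor E' F' :=
  (TensorProduct.mapL A B).completion

lemma hmap_htmul {E' F' : Type*} [NormedAddCommGroup E'] [InnerProductSpace ℂ E']
    [NormedAddCommGroup F'] [InnerProductSpace ℂ F'] (A : E →L[ℂ] E') (B : F →L[ℂ] F')
    (e : E) (f : F) : hmap A B (htmul e f) = htmul (A e) (B f) := by
  simp [hmap, htmul]

lemma inner_htmul (e e' : E) (f f' : F) :
    inner ℂ (htmul e f) (htmul e' f') = inner ℂ e e' * inner ℂ f f' := by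
  simp [htmul]

/-- Pairing the first tensor factor with `g`: the bounded operator `h ⊗ f ↦ ⟪g, h⟫ f`
(see `contractL_htmul`). -/
def contractL [CompleteSpace F] (g : E) : HTensor E F →L[ℂ] F :=
  ContinuousLinearMap.adjoint (htmulL g)

lemma contractL_htmul [CompleteSpace F] (g h : E) (f : F) :
    contractL g (htmul h f) = inner ℂ g h • f := by
  refine ext_inner_right ℂ fun e => ?_
  rw [contractL, ContinuousLinearMap.adjoint_inner_left, htmulL_apply, inner_htmul,
    inner_smul_left, inner_conj_symm]

end HilbertTensor

/-! ### Tensor powers and symmetric tensor powers -/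

/-- A bundled complex Hilbert space, used only to define the tensor powers by recursion. -/
structure HilbertSp : Type (u + 1) where
  carrier : Type u
  [instNormed : NormedAddCommGroup carrier]
  [instInner : InnerProductSpace ℂ carrier]
  [instComplete : CompleteSpace carrier]

section Powers

variable (H : Type u) [NormedAddCommGroup H] [InnerProductSpace ℂ H]

/-- `H^{⊗0}` is the one-dimensional space and `H^{⊗(k+1)} = H ⊗ H^{⊗k}`. -/
def tensorPowSp : ℕ → HilbertSp.{u}
  | 0 => ⟨EuclideanSpace ℂ PUnit.{u + 1}⟩
  | k + 1 =>
    letI := (tensorPowSp k).instNormed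
    letI := (tensorPowSp k).instInner
    ⟨HTensor H (tensorPowSp k).carrier⟩

/-- The `k`-th Hilbert tensor power `H^{⊗k}`. -/
def TensorPow (k : ℕ) : Type u := (tensorPowSp H k).carrier

instance (k : ℕ) : NormedAddCommGroup (TensorPow H k) := (tensorPowSp H k).instNormed
instance (k : ℕ) : InnerProductSpace ℂ (TensorPow H k) := (tensorPowSp H k).instInner
instance (k : ℕ) : CompleteSpace (TensorPow H k) := (tensorPowSp H k).instComplete

variable {H}

/-- The elementary tensor `h 0 ⊗ h 1 ⊗ ⋯ ⊗ h (k - 1)` in `H^{⊗k}`. -/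
def elemTensor : (k : ℕ) → (Fin k → H) → TensorPow H k
  | 0, _ => (EuclideanSpace.single PUnit.unit 1 : EuclideanSpace ℂ PUnit.{u + 1})
  | k + 1, h => (htmul (h 0) (elemTensor k (Fin.tail h)) : HTensor H (TensorPow H k))

/-- Pairing the first tensor factor of `H^{⊗(k+1)} = H ⊗ H^{⊗k}` with `g`. -/
def contractPow (k : ℕ) (g : H) : TensorPow H (k + 1) →L[ℂ] TensorPow H k :=
  (contractL g : HTensor H (TensorPow H k) →L[ℂ] TensorPow H k)

lemma contractPow_elemTensor (k : ℕ) (g : H) (h : Fin (k + 1) → H) :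
    contractPow k g (elemTensor (k + 1) h) = inner ℂ g (h 0) • elemTensor k (Fin.tail h) :=
  contractL_htmul g (h 0) (elemTensor k (Fin.tail h))

/-- The symmetrization of `h 0 ⊗ ⋯ ⊗ h (k - 1)`. -/
def symElem (k : ℕ) (h : Fin k → H) : TensorPow H k :=
  ((k.factorial : ℂ)⁻¹) • ∑ σ : Equiv.Perm (Fin k), elemTensor k (h ∘ σ)

variable (H) in
/-- The symmetric Hilbert tensor power `H^{⊙k}`: the closed linear span in `H^{⊗k}` of the
symmetrized elementary tensors. -/
def SymPow (k : ℕ) : Submodule ℂ (TensorPow H k) :=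
  (Submodule.span ℂ (Set.range (symElem (H := H) k))).topologicalClosure

lemma symElem_mem (k : ℕ) (h : Fin k → H) : symElem k h ∈ SymPow H k :=
  Submodule.le_topologicalClosure _ (Submodule.subset_span ⟨h, rfl⟩)

lemma elemTensor_const_mem (k : ℕ) (h : H) : elemTensor k (fun _ => h) ∈ SymPow H k := by
  have e : symElem k (fun _ => h) = elemTensor k (fun _ => h) := by
    have : ((k.factorial : ℂ)) ≠ 0 := by exact_mod_cast k.factorial_ne_zero
    simp [symElem, Function.comp_def, Fintype.card_perm, ← Nat.cast_smul_eq_nsmul ℂ, smul_smul,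
      inv_mul_cancel₀ this]
  exact e ▸ symElem_mem k _

/-- `h^{⊗k}` as an element of `H^{⊙k}`. -/
def symPower (k : ℕ) (h : H) : SymPow H k := ⟨elemTensor k fun _ => h, elemTensor_const_mem k h⟩

lemma contractPow_symElem_mem (k : ℕ) (g : H) (h : Fin (k + 1) → H) :
    contractPow k g (symElem (k + 1) h) ∈ SymPow H k := by
  rw [symElem, map_smul, map_sum]
  refine Submodule.smul_mem _ _ ?_
  rw [← Equiv.sum_comp Equiv.Perm.decomposeFin.symm, Fintype.sum_prod_type]
  refine Submodule.sum_mem _ fun p _ => ?_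
  have key : ∀ e : Equiv.Perm (Fin k),
      contractPow k g (elemTensor (k + 1) (h ∘ Equiv.Perm.decomposeFin.symm (p, e))) =
        inner ℂ g (h p) • elemTensor k ((fun i => h (Equiv.swap 0 p i.succ)) ∘ e) := by
    intro e
    rw [contractPow_elemTensor]
    congr 2
    · simp
    · ext i
      simp [Fin.tail]
  simp_rw [key]
  rw [← Finset.smul_sum]
  refine Submodule.smul_mem _ _ ?_
  have h0 : ((k.factorial : ℂ)) ≠ 0 := by exact_mod_cast k.factorial_ne_zero
  have := Submodule.smul_mem _ (k.factorial : ℂ)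
    (symElem_mem k fun i : Fin k => h (Equiv.swap 0 p i.succ))
  rwa [symElem, smul_smul, mul_inv_cancel₀ h0, one_smul] at this

lemma contractPow_mem (k : ℕ) (g : H) (x : TensorPow H (k + 1)) (hx : x ∈ SymPow H (k + 1)) :
    contractPow k g x ∈ SymPow H k := by
  have h1 : SymPow H (k + 1) ≤ (SymPow H k).comap (contractPow k g).toLinearMap := by
    refine Submodule.topologicalClosure_minimal _ ?_ ?_
    · rw [Submodule.span_le]
      rintro _ ⟨h, rfl⟩
      exact contractPow_symElem_mem k g h
    · exact (Submodule.isClosed_topologicalClosure _).preimage (contractPow k g).continuous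
  exact h1 hx

/-- Pairing one variable of a symmetric kernel with `g`; informally
`f ↦ ∫ f(t, ·) * conj (g t) dt`, so `h^{⊗(k+1)} ↦ ⟪g, h⟫ h^{⊗k}`. -/
def contractSym (k : ℕ) (g : H) : SymPow H (k + 1) →L[ℂ] SymPow H k :=
  ((contractPow k g).comp (SymPow H (k + 1)).subtypeL).codRestrict (SymPow H k)
    fun x => contractPow_mem k g x x.2

variable (H) in
/-- The space of kernels `H^{⊙m} ⊗ H^{⊙n}`. -/
abbrev KernelSp (m n : ℕ) : Type u := HTensor (SymPow H m) (SymPow H n)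

/-- Pairing one of the first `m + 1` variables of a kernel with `g`. -/
def sliceLeft (m n : ℕ) (g : H) : KernelSp H (m + 1) n →L[ℂ] KernelSp H m n :=
  hmap (contractSym m g) (ContinuousLinearMap.id ℂ (SymPow H n))

/-- Pairing one of the last `n + 1` variables of a kernel with `g`. -/
def sliceRight (m n : ℕ) (g : H) : KernelSp H m (n + 1) →L[ℂ] KernelSp H m n :=
  hmap (ContinuousLinearMap.id ℂ (SymPow H m)) (contractSym n g)

end Powers

/-! ### Complex isonormal Gaussian processes and Wiener–Itô integrals -/

section Gaussian

variable {H : Type u} [NormedAddCommGroup H] [InnerProductSpace ℂ H]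
  {Ω : Type v} [MeasurableSpace Ω]

/-- A complex isonormal Gaussian process over `H`: a centred (jointly) Gaussian family of complex
random variables with `E[Z(g) conj Z(h)] = ⟨g, h⟩` (linear in `g`) and `E[Z(g) Z(h)] = 0`. Mathlib's
`inner` is linear in the second slot. -/
structure IsComplexIsonormal (Z : H → Ω → ℂ) (P : Measure Ω) : Prop where
  measurable : ∀ h, Measurable (Z h)
  gaussian : IsGaussianProcess Z P
  mean_zero : ∀ h, ∫ ω, Z h ω ∂P = 0
  covariance : ∀ g h, ∫ ω, Z g ω * conj (Z h ω) ∂P = inner ℂ h g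
  relation : ∀ g h, ∫ ω, Z g ω * Z h ω ∂P = 0

/-- Up to null sets, the σ-algebra of `Ω` is the one generated by `Z`, so that `L²(Ω)` is
`L²(Ω, σ(Z))`. -/
def SigmaAlgebraGeneratedBy (Z : H → Ω → ℂ) (P : Measure Ω) : Prop :=
  ∀ s : Set Ω, MeasurableSet s →
    ∃ t : Set Ω, MeasurableSet[⨆ h, MeasurableSpace.comap (Z h) inferInstance] t ∧ s =ᵐ[P] t

/-- The complex Hermite polynomial
`J_{m,n}(z, ρ) = ∑_k (-1)^k k! (m choose k) (n choose k) z^{m-k} (conj z)^{n-k} ρ^k`. -/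
def complexHermite (m n : ℕ) (z : ℂ) (ρ : ℝ) : ℂ :=
  ∑ k ∈ Finset.range (min m n + 1),
    (-1) ^ k * (k.factorial : ℂ) * (m.choose k : ℂ) * (n.choose k : ℂ) *
      z ^ (m - k) * (conj z) ^ (n - k) * (ρ : ℂ) ^ k

/-- The bounded operator `T` is the complex Wiener–Itô integral of bidegree `(m, n)`:
it maps `h^{⊗m} ⊗ (conj h)^{⊗n}` to `J_{m,n}(Z(h), ‖h‖²)`. Here `cj` is the complex conjugation
of `H`. -/
def IsWienerIto (cj : H ≃ₗᵢ⋆[ℂ] H) (Z : H → Ω → ℂ) (P : Measure Ω) (m n : ℕ)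
    (T : KernelSp H m n →L[ℂ] Lp ℂ 2 P) : Prop :=
  ∀ h : H, ∀ᵐ ω ∂P, T (htmul (symPower m h) (symPower n (cj h))) ω =
    complexHermite m n (Z h ω) (‖h‖ ^ 2)

open Classical in
/-- The complex Wiener–Itô integral `I_{m,n} : H^{⊙m} ⊗ H^{⊙n} → L²(Ω)`, the bounded operator
singled out by `IsWienerIto`. -/
def wienerIto (cj : H ≃ₗᵢ⋆[ℂ] H) (Z : H → Ω → ℂ) (P : Measure Ω) (m n : ℕ) :
    KernelSp H m n →L[ℂ] Lp ℂ 2 P :=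
  if h : ∃ T, IsWienerIto cj Z P m n T then h.choose else 0

/-! ### Malliavin derivatives, divergences, Ornstein–Uhlenbeck operators -/

/-- The Wirtinger derivative `∂f/∂z_j`. -/
def wirtinger {k : ℕ} (f : (Fin k → ℂ) → ℂ) (j : Fin k) (z : Fin k → ℂ) : ℂ :=
  (fderiv ℝ f z (Pi.single j 1) - Complex.I * fderiv ℝ f z (Pi.single j Complex.I)) / 2

/-- The Wirtinger derivative `∂f/∂(conj z_j)`. -/
def wirtingerBar {k : ℕ} (f : (Fin k → ℂ) → ℂ) (j : Fin k) (z : Fin k → ℂ) : ℂ :=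
  (fderiv ℝ f z (Pi.single j 1) + Complex.I * fderiv ℝ f z (Pi.single j Complex.I)) / 2

variable (Z : H → Ω → ℂ) (P : Measure Ω)

/-- `D` on the class of smooth random variables `F = f(Z(φ_1), …, Z(φ_k))`, where `f` is smooth and
it and all its derivatives have polynomial growth: `D F = ∑ ∂_j f(Z(φ)) φ_j`. It is
given by its graph. -/
def smoothD : Lp ℂ 2 P →ₗ.[ℂ] Lp H 2 P :=
  (Submodule.span ℂ {q : Lp ℂ 2 P × Lp H 2 P |
    ∃ (k : ℕ) (f : (Fin k → ℂ) → ℂ) (φ : Fin k → H), Function.HasTemperateGrowth f ∧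
      (∀ᵐ ω ∂P, q.1 ω = f fun i => Z (φ i) ω) ∧
      (∀ᵐ ω ∂P, q.2 ω = ∑ j, wirtinger f j (fun i => Z (φ i) ω) • φ j)}).toLinearPMap

/-- `D̄` on smooth random variables: `D̄ F = ∑ ∂̄_j f(Z(φ)) conj φ_j`. -/
def smoothDBar (cj : H ≃ₗᵢ⋆[ℂ] H) : Lp ℂ 2 P →ₗ.[ℂ] Lp H 2 P :=
  (Submodule.span ℂ {q : Lp ℂ 2 P × Lp H 2 P |
    ∃ (k : ℕ) (f : (Fin k → ℂ) → ℂ) (φ : Fin k → H), Function.HasTemperateGrowth f ∧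
      (∀ᵐ ω ∂P, q.1 ω = f fun i => Z (φ i) ω) ∧
      (∀ᵐ ω ∂P, q.2 ω = ∑ j, wirtingerBar f j (fun i => Z (φ i) ω) • cj (φ j))}).toLinearPMap

/-- The Malliavin derivative `D` with domain `𝔻^{1,2}`, the closure of `smoothD`. -/
def malliavinD : Lp ℂ 2 P →ₗ.[ℂ] Lp H 2 P := (smoothD Z P).closure

/-- The Malliavin derivative `D̄` with its domain, the closure of `smoothDBar`. -/
def malliavinDBar (cj : H ≃ₗᵢ⋆[ℂ] H) : Lp ℂ 2 P →ₗ.[ℂ] Lp H 2 P := (smoothDBar Z P cj).closure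

/-- The divergence `δ`, the Hilbert space adjoint of `D` (tested on smooth random variables):
`E[δu · conj F] = E⟨u, DF⟩`. -/
def divergence [CompleteSpace H] : Lp H 2 P →ₗ.[ℂ] Lp ℂ 2 P := (smoothD Z P).adjoint

/-- The divergence `δ̄`, the Hilbert space adjoint of `D̄`. -/
def divergenceBar [CompleteSpace H] (cj : H ≃ₗᵢ⋆[ℂ] H) : Lp H 2 P →ₗ.[ℂ] Lp ℂ 2 P :=
  (smoothDBar Z P cj).adjoint

/-- Composition `S ∘ T` of unbounded operators on its natural domain
`{x ∈ dom T | T x ∈ dom S}`. -/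
def pmapComp {A B C : Type*} [AddCommGroup A] [Module ℂ A] [AddCommGroup B] [Module ℂ B]
    [AddCommGroup C] [Module ℂ C] (S : B →ₗ.[ℂ] C) (T : A →ₗ.[ℂ] B) : A →ₗ.[ℂ] C :=
  S.comp (T.domRestrict ((S.domain.comap T.toFun).map T.domain.subtype)) (by
    rintro ⟨x, hx, hT⟩
    obtain ⟨y, hy, rfl⟩ := hx
    exact hy)

/-- The complex Ornstein–Uhlenbeck operator `L = δ D`. -/
def ouL [CompleteSpace H] : Lp ℂ 2 P →ₗ.[ℂ] Lp ℂ 2 P := pmapComp (divergence Z P) (malliavinD Z P)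

/-- The complex Ornstein–Uhlenbeck operator `L̄ = δ̄ D̄`. -/
def ouLBar [CompleteSpace H] (cj : H ≃ₗᵢ⋆[ℂ] H) : Lp ℂ 2 P →ₗ.[ℂ] Lp ℂ 2 P :=
  pmapComp (divergenceBar Z P cj) (malliavinDBar Z P cj)

end Gaussian

end

/-! On a diagonal tensor `h^{⊗m} ⊗ (cj h)^{⊗n}` every claim is a computation with `J_{m,n}(Z h,
‖h‖²)`; totality of these tensors and closedness of the graph of `D` carry it to all kernels.

Two Hermite identities do the computation. `∂_z J_{m+1,n} = (m+1) J_{m,n}` gives `D J_{m+1,n}(Z h) =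
(m+1) J_{m,n}(Z h) h`. The recursion `J_{m+1,n+1} = z J_{m,n+1} - (n+1) ρ J_{m,n}`, read through
Gaussian integration by parts (`inner_smoothGraph`), says that `J_{m+1,n}(Z h)` is the divergence of
`J_{m,n}(Z h) h`. Hence `δ D` multiplies by `m+1`. The same two facts lower `m` in inner products
and show that the Gram matrix of the Hermite variables is `m! n!` times that of the diagonal tensors
(`inner_hermiteVec`), so `I_{m,n}` exists as a multiple of an isometry. The gradients also have a
Gram matrix proportional to that of the tensors, so the derivative too is a bounded operator of the
kernel.

Totality (`isTotal_diagTensor`) is infinitesimal polarization: if `x` is orthogonal to all diagonal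
tensors, differentiating in the directions `g` and `i g` separates the two slots and shows that the
slices of `x` have the same property in lower degree.

Integration by parts comes from Stein's identity, proved by regressing one Gaussian variable on
another. Together with the density of smooth variables it makes `D` well defined, closable and
densely defined. The barred statements are the unbarred ones for the process `h ↦ conj (Z (cj h))`,
which exchanges `D` with `D̄` and `m` with `n` (`smoothDBar_eq`, `hermiteVec_conjProcess`). -/

/-! ### Functions of temperate growth of Gaussian vectors -/

section Stein

variable {E F : Type*} [NormedAddCommGroup E] [NormedSpace ℝ E]
  [NormedAddCommGroup F] [NormedSpace ℝ F]

lemma Function.HasTemperateGrowth.fderiv_apply {f : E → F} (hf : f.HasTemperateGrowth) (c : E) :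
    Function.HasTemperateGrowth fun x => fderiv ℝ f x c := by
  have h : Function.HasTemperateGrowth (fderiv ℝ f) := by
    refine ⟨hf.1.fderiv_right (by simp), fun n => ?_⟩
    obtain ⟨k, C, h⟩ := hf.2 (n + 1)
    exact ⟨k, C, fun x => by rw [norm_iteratedFDeriv_fderiv]; exact h x⟩
  exact (ContinuousLinearMap.apply ℝ F c).hasTemperateGrowth.comp h

lemma Function.HasTemperateGrowth.differentiable {f : E → F} (hf : f.HasTemperateGrowth) :
    Differentiable ℝ f := hf.1.differentiable (by simp)

lemma Function.HasTemperateGrowth.continuous {f : E → F} (hf : f.HasTemperateGrowth) :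
    Continuous f := hf.1.continuous

variable [FiniteDimensional ℝ E] [MeasurableSpace E] [BorelSpace E]
  {Ω : Type*} [MeasurableSpace Ω] {P : Measure Ω}

/-- Gaussian vectors have moments of all orders, and `f` is dominated by a power of `1 + ‖Y‖`. -/
lemma ProbabilityTheory.HasGaussianLaw.memLp_comp {Y : Ω → E} (hY : HasGaussianLaw Y P)
    {f : E → ℂ} (hf : f.HasTemperateGrowth) {p : ℝ≥0∞} (hp : p ≠ ∞) :
    MemLp (fun ω => f (Y ω)) p P := by
  have : FiniteDimensional ℝ E := inferInstance
  have : CompleteSpace E := FiniteDimensional.complete ℝ E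
  have : SecondCountableTopology E := inferInstance
  have := hY.isProbabilityMeasure
  obtain ⟨k, C, h⟩ := hf.2 0
  -- The exponent `k + 1` instead of `k` is nonzero, so that it can be cancelled in `p * N / N`.
  obtain ⟨N, hN⟩ : ∃ N : ℕ, N = k + 1 := ⟨_, rfl⟩
  have hN0 : (N : ℝ≥0∞) ≠ 0 := by simp [hN]
  have h1 : MemLp (fun ω => (1 : ℝ) + ‖Y ω‖) (p * (N : ℝ≥0∞)) P :=
    (memLp_const (1 : ℝ)).add (hY.memLp (ENNReal.mul_ne_top hp (by simp))).norm
  have h2 := h1.norm_rpow_div (N : ℝ≥0∞)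
  rw [ENNReal.mul_div_cancel_right hN0 (by simp)] at h2
  refine (h2.const_mul C).mono
    (hf.continuous.comp_aestronglyMeasurable hY.aemeasurable.aestronglyMeasurable)
    (Filter.Eventually.of_forall fun ω => ?_)
  have hC : 0 ≤ C := by simpa using (norm_nonneg _).trans (h 0)
  have h3 := h (Y ω)
  simp only [norm_iteratedFDeriv_zero] at h3
  refine h3.trans ?_
  have hpos : 0 ≤ 1 + ‖Y ω‖ := by positivity
  rw [norm_mul, Real.norm_of_nonneg hC, ENNReal.toReal_natCast, Real.rpow_natCast,
    Real.norm_of_nonneg hpos, Real.norm_of_nonneg (pow_nonneg hpos _)]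
  exact mul_le_mul_of_nonneg_left (pow_le_pow_right₀ (by simp) (by omega)) hC

lemma ProbabilityTheory.HasGaussianLaw.integrable_comp {Y : Ω → E} (hY : HasGaussianLaw Y P)
    {f : E → ℂ} (hf : f.HasTemperateGrowth) : Integrable (fun ω => f (Y ω)) P :=
  memLp_one_iff_integrable.1 (hY.memLp_comp hf (by simp))

/-- The density satisfies `ρ' = -(x / v) ρ`, so this is integration by parts on the line. For `v =
0` the law is a Dirac mass at `0` and both sides vanish. -/
lemma integral_id_mul_gaussianReal (v : NNReal) {φ φ' : ℝ → ℂ}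
    (hφ : ∀ x, HasDerivAt φ (φ' x) x) (h0 : Integrable φ (gaussianReal 0 v))
    (h1 : Integrable (fun x : ℝ => (x : ℂ) * φ x) (gaussianReal 0 v))
    (h2 : Integrable φ' (gaussianReal 0 v)) :
    ∫ x : ℝ, (x : ℂ) * φ x ∂gaussianReal 0 v = v * ∫ x, φ' x ∂gaussianReal 0 v := by
  rcases eq_or_ne v 0 with rfl | hv
  · simp
  have hv' : (v : ℂ) ≠ 0 := by exact_mod_cast hv
  have hvr : (v : ℝ) ≠ 0 := by exact_mod_cast hv
  have key : ∀ g : ℝ → ℂ, Integrable g (gaussianReal 0 v) →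
      Integrable (fun x => (gaussianPDFReal 0 v x : ℂ) * g x) := by
    intro g hg
    rw [gaussianReal_of_var_ne_zero _ hv, integrable_withDensity_iff_integrable_smul'
      (measurable_gaussianPDF 0 v) (Filter.Eventually.of_forall fun _ => gaussianPDF_lt_top)] at hg
    simpa [toReal_gaussianPDF] using hg
  have hd : ∀ x : ℝ, HasDerivAt (fun x : ℝ => (gaussianPDFReal 0 v x : ℂ))
      (-((x : ℂ) / v) * gaussianPDFReal 0 v x) x := by
    intro x
    have h : HasDerivAt (gaussianPDFReal 0 v) (-(x / v) * gaussianPDFReal 0 v x) x := by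
      have h3 : HasDerivAt (fun x : ℝ => -(x - 0) ^ 2 / (2 * (v : ℝ))) (-(x / v)) x := by
        have h4 := (((hasDerivAt_id x).sub_const 0).pow 2).neg.div_const (2 * (v : ℝ))
        refine h4.congr_deriv ?_
        simp
        field_simp
      have h5 := h3.exp.const_mul (√(2 * Real.pi * v))⁻¹
      rw [gaussianPDFReal_def]
      refine h5.congr_deriv ?_
      ring
    simpa using h.ofReal_comp
  have h3 := integral_mul_deriv_eq_deriv_mul_of_integrable (u := φ) (u' := φ')
    (v := fun x : ℝ => (gaussianPDFReal 0 v x : ℂ))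
    (v' := fun x => -((x : ℂ) / v) * gaussianPDFReal 0 v x) (fun x _ => hφ x) (fun x _ => hd x)
    (by
      refine ((key _ h1).const_mul (-(1 / (v : ℂ)))).congr (.of_forall fun x => ?_)
      simp only [Pi.mul_apply]
      ring)
    (by
      refine (key _ h2).congr (.of_forall fun x => ?_)
      simp only [Pi.mul_apply]
      ring)
    (by
      refine (key _ h0).congr (.of_forall fun x => ?_)
      simp only [Pi.mul_apply]
      ring)
  rw [integral_gaussianReal_eq_integral_smul hv, integral_gaussianReal_eq_integral_smul hv]
  simp only [Complex.real_smul]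
  have e1 : ∫ x, (gaussianPDFReal 0 v x : ℂ) * φ' x = ∫ x, φ' x * gaussianPDFReal 0 v x := by
    congr with x; ring
  rw [e1, ← neg_eq_iff_eq_neg.2 h3, ← integral_neg, ← integral_const_mul]
  congr with x
  field_simp

/-- Stein's identity for `g (x c + w)` with `x` a centred Gaussian variable independent of `w`. -/
lemma integral_mul_comp_of_indepFun {X : Ω → ℝ} {W : Ω → E} {v : NNReal}
    (hXW : HasGaussianLaw (fun ω => (X ω, W ω)) P) (hind : IndepFun X W P)
    (hX : P.map X = gaussianReal 0 v) (c : E) {g : E → ℂ} (hg : g.HasTemperateGrowth) :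
    ∫ ω, (X ω : ℂ) * g (X ω • c + W ω) ∂P = v * ∫ ω, fderiv ℝ g (X ω • c + W ω) c ∂P := by
  have : CompleteSpace E := FiniteDimensional.complete ℝ E
  have : SecondCountableTopology E := inferInstance
  have := hXW.isProbabilityMeasure
  have mXW := hXW.aemeasurable
  have mX : AEMeasurable X P := measurable_fst.comp_aemeasurable mXW
  have mW : AEMeasurable W P := measurable_snd.comp_aemeasurable mXW
  -- The joint law is a product, so for almost every fixed `w` the one-dimensional identity applies
  -- to `x ↦ g (x c + w)`.
  have hpair := (indepFun_iff_map_prod_eq_prod_map_map mX mW).1 hind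
  rw [hX] at hpair
  let A : ℝ × E →L[ℝ] E :=
    (ContinuousLinearMap.fst ℝ ℝ E).smulRight c + ContinuousLinearMap.snd ℝ ℝ E
  have hfst : Function.HasTemperateGrowth fun q : ℝ × E => (q.1 : ℂ) :=
    (Complex.ofRealCLM ∘L ContinuousLinearMap.fst ℝ ℝ E).hasTemperateGrowth
  have hG : ∀ f : E → ℂ, f.HasTemperateGrowth →
      Function.HasTemperateGrowth fun q : ℝ × E => f (q.1 • c + q.2) := fun f hf =>
    hf.comp A.hasTemperateGrowth
  have hg' := hg.fderiv_apply c
  have tr : ∀ f : ℝ × E → ℂ, f.HasTemperateGrowth →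
      Integrable f ((gaussianReal 0 v).prod (P.map W)) ∧
      ∫ ω, f (X ω, W ω) ∂P = ∫ w, ∫ x, f (x, w) ∂gaussianReal 0 v ∂P.map W := by
    intro f hf
    have hi : Integrable f ((gaussianReal 0 v).prod (P.map W)) := by
      rw [← hpair, integrable_map_measure hf.continuous.aestronglyMeasurable mXW]
      exact hXW.integrable_comp hf
    refine ⟨hi, ?_⟩
    rw [← integral_prod_symm f hi, ← hpair,
      integral_map mXW hf.continuous.aestronglyMeasurable]
  obtain ⟨i1, e1⟩ := tr (fun q => (q.1 : ℂ) * g (q.1 • c + q.2)) (hfst.mul (hG _ hg))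
  obtain ⟨i2, e2⟩ := tr (fun q => fderiv ℝ g (q.1 • c + q.2) c) (hG _ hg')
  obtain ⟨i3, -⟩ := tr (fun q => g (q.1 • c + q.2)) (hG _ hg)
  rw [e1, e2, ← integral_const_mul]
  refine integral_congr_ae ?_
  filter_upwards [i1.prod_left_ae, i2.prod_left_ae, i3.prod_left_ae] with w h1 h2 h3
  refine integral_id_mul_gaussianReal v (fun x => ?_) h3 h1 h2
  have hl : HasDerivAt (fun x : ℝ => x • c + w) c x := by
    simpa using ((hasDerivAt_id x).smul_const c).add_const w
  exact (hg.differentiable _).hasFDerivAt.comp_hasDerivAt x hl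

/-- Stein's identity `E[X g(Y)] = E[Dg(Y) (E[X Y])]` for jointly Gaussian `X, Y`, `X` centred. -/
theorem ProbabilityTheory.HasGaussianLaw.integral_mul_comp {X : Ω → ℝ} {Y : Ω → E}
    (hXY : HasGaussianLaw (fun ω => (X ω, Y ω)) P) (hX : ∫ ω, X ω ∂P = 0)
    {g : E → ℂ} (hg : g.HasTemperateGrowth) :
    ∫ ω, (X ω : ℂ) * g (Y ω) ∂P = ∫ ω, fderiv ℝ g (Y ω) (∫ ω, X ω • Y ω ∂P) ∂P := by
  have : CompleteSpace E := FiniteDimensional.complete ℝ E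
  have : SecondCountableTopology E := inferInstance
  have := hXY.isProbabilityMeasure
  have hXg : HasGaussianLaw X P := hXY.fst
  have hYg : HasGaussianLaw Y P := hXY.snd
  have hint : Integrable (fun ω => X ω • Y ω) P := by
    refine memLp_one_iff_integrable.1 ?_
    exact hYg.memLp_two.smul (p := 2) hXg.memLp_two
  set m := ∫ ω, X ω • Y ω ∂P with hm
  set v := Var[X; P] with hv
  have hv2 : v = ∫ ω, X ω ^ 2 ∂P := variance_of_integral_eq_zero hXg.aemeasurable hX
  rcases eq_or_ne v 0 with h0 | h0
  · have hX0 : X =ᵐ[P] 0 := by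
      rw [hv2] at h0
      rw [integral_eq_zero_iff_of_nonneg (fun ω => sq_nonneg _) hXg.memLp_two.integrable_sq] at h0
      filter_upwards [h0] with ω h
      simpa using h
    have hm0 : m = 0 := by
      rw [hm, integral_eq_zero_of_ae]
      filter_upwards [hX0] with ω h
      simp [h]
    rw [hm0, integral_eq_zero_of_ae]
    · simp
    · filter_upwards [hX0] with ω h
      simp [h]
  -- Gaussian regression: subtracting `X • E[X Y] / v` from `Y` leaves a vector uncorrelated with
  -- `X`, hence independent of it by joint Gaussianity.
  set W : Ω → E := fun ω => Y ω - X ω • (v⁻¹ • m) with hW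
  have hXW : HasGaussianLaw (fun ω => (X ω, W ω)) P := by
    let B : ℝ × E →L[ℝ] ℝ × E := (ContinuousLinearMap.fst ℝ ℝ E).prod
      (ContinuousLinearMap.snd ℝ ℝ E - (ContinuousLinearMap.fst ℝ ℝ E).smulRight (v⁻¹ • m))
    exact hXY.map_fun B
  have hind : IndepFun X W P := by
    refine hXW.indepFun_of_covariance_strongDual fun L₁ L₂ => ?_
    have hWg : HasGaussianLaw W P := hXW.snd
    have hL : ∀ x : ℝ, L₁ x = L₁ 1 * x := fun x => by
      conv_lhs => rw [← mul_one x, ← smul_eq_mul, map_smul, smul_eq_mul, mul_comm]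
    have e : ⇑L₁ ∘ X = fun ω => L₁ 1 * X ω := by
      ext ω; simp [hL (X ω)]
    rw [e, covariance_const_mul_left, covariance_eq_sub hXg.memLp_two (hWg.map L₂).memLp_two, hX]
    have hXW' : ∫ ω, X ω • W ω ∂P = 0 := by
      have e2 : ∀ ω, X ω • W ω = X ω • Y ω - (X ω ^ 2) • (v⁻¹ • m) := by
        intro ω
        simp only [hW, smul_sub, smul_smul, sq]
        simp [mul_assoc]
      simp only [e2]
      rw [integral_sub hint (hXg.memLp_two.integrable_sq.smul_const _), integral_smul_const,
        ← hv2, ← hm, smul_smul, mul_inv_cancel₀ h0, one_smul, sub_self]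
    have hint' : Integrable (fun ω => X ω • W ω) P := by
      refine memLp_one_iff_integrable.1 ?_
      exact hWg.memLp_two.smul (p := 2) hXg.memLp_two
    have e3 := L₂.integral_comp_comm hint'
    rw [hXW'] at e3
    simp only [map_smul, smul_eq_mul, map_zero] at e3
    simp only [Pi.mul_apply, Function.comp_apply]
    rw [e3]
    simp
  have hmap := hXg.map_eq_gaussianReal
  rw [hX] at hmap
  have h := integral_mul_comp_of_indepFun hXW hind hmap (v⁻¹ • m) hg
  have e : ∀ ω, X ω • (v⁻¹ • m) + W ω = Y ω := fun ω => by simp [hW]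
  simp only [e] at h
  -- The factor `v` of Stein's identity cancels the `v⁻¹` in the direction of differentiation.
  rw [h, Real.coe_toNNReal _ (variance_nonneg _ _), ← integral_const_mul]
  congr with ω
  rw [map_smul, ← hv, Complex.real_smul, ← mul_assoc, ← Complex.ofReal_mul, mul_inv_cancel₀ h0]
  simp

end Stein

/-! ### Wirtinger derivatives in a direction -/

/-- The complex linear part of the real derivative of `f` at `y`, applied to `a`. -/
noncomputable def wirtingerDir {ι : Type*} [Fintype ι] (f : (ι → ℂ) → ℂ) (a y : ι → ℂ) : ℂ :=
  (fderiv ℝ f y a - Complex.I * fderiv ℝ f y (Complex.I • a)) / 2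

section Wirtinger

variable {ι κ : Type*} [Fintype ι] [Fintype κ]

/-- Expand the real derivative in the real basis `e_j, i e_j`; the combination keeps only its
complex linear part. -/
lemma wirtingerDir_eq_sum {k : ℕ} (f : (Fin k → ℂ) → ℂ) (a y : Fin k → ℂ) :
    wirtingerDir f a y = ∑ j, a j * wirtinger f j y := by
  set L := fderiv ℝ f y
  have h1 : ∀ b : Fin k → ℂ, L b = ∑ j, (((b j).re : ℂ) * L (Pi.single j 1) +
      ((b j).im : ℂ) * L (Pi.single j Complex.I)) := by
    intro b
    have hb : b = ∑ j, ((b j).re • (Pi.single j (1 : ℂ) : Fin k → ℂ) +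
        (b j).im • (Pi.single j Complex.I : Fin k → ℂ)) := by
      ext i
      simp only [Finset.sum_apply, Pi.add_apply, Pi.smul_apply, Pi.single_apply]
      rw [Finset.sum_eq_single i]
      · simp
      · intro j _ hj
        simp [hj.symm]
      · simp
    conv_lhs => rw [hb]
    simp [map_sum]
  rw [wirtingerDir, h1 a, h1 (Complex.I • a), Finset.mul_sum, ← Finset.sum_sub_distrib,
    Finset.sum_div]
  refine Finset.sum_congr rfl fun j _ => ?_
  rw [wirtinger]
  conv_rhs => rw [← Complex.re_add_im (a j)]
  simp only [Pi.smul_apply, smul_eq_mul, Complex.mul_re, Complex.mul_im, Complex.I_re,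
    Complex.I_im]
  push_cast
  linear_combination ((a j).im : ℂ) / 2 * fderiv ℝ f y (Pi.single j Complex.I) * Complex.I_sq

lemma wirtingerDir_mul {f g : (ι → ℂ) → ℂ} {y : ι → ℂ} (hf : DifferentiableAt ℝ f y)
    (hg : DifferentiableAt ℝ g y) (a : ι → ℂ) :
    wirtingerDir (fun z => f z * g z) a y =
      wirtingerDir f a y * g y + f y * wirtingerDir g a y := by
  simp only [wirtingerDir, fderiv_fun_mul hf hg]
  simp
  ring

lemma wirtingerDir_comp {f : (κ → ℂ) → ℂ} (r : κ → ι) (a y : ι → ℂ)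
    (hf : DifferentiableAt ℝ f (y ∘ r)) :
    wirtingerDir (fun z => f (z ∘ r)) a y = wirtingerDir f (a ∘ r) (y ∘ r) := by
  let R : (ι → ℂ) →L[ℝ] (κ → ℂ) := ContinuousLinearMap.pi fun j => ContinuousLinearMap.proj (r j)
  have h : HasFDerivAt (fun z : ι → ℂ => f (z ∘ r)) (fderiv ℝ f (y ∘ r) ∘L R) y :=
    HasFDerivAt.comp (g := f) (f := R) y hf.hasFDerivAt R.hasFDerivAt
  simp only [wirtingerDir, h.fderiv]
  rfl

lemma Function.HasTemperateGrowth.wirtingerDir {f : (ι → ℂ) → ℂ} (hf : f.HasTemperateGrowth)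
    (a : ι → ℂ) : Function.HasTemperateGrowth (wirtingerDir f a) := by
  have h1 := hf.fderiv_apply a
  have h2 := hf.fderiv_apply (Complex.I • a)
  have h3 : Function.HasTemperateGrowth fun y => (2 : ℂ)⁻¹ * (fderiv ℝ f y a -
      Complex.I * fderiv ℝ f y (Complex.I • a)) :=
    (Function.HasTemperateGrowth.const _).mul
      (h1.sub ((Function.HasTemperateGrowth.const _).mul h2))
  convert! h3 using 1
  ext y
  simp only [_root_.wirtingerDir]
  ring

lemma Function.HasTemperateGrowth.comp_right {f : (κ → ℂ) → ℂ} (hf : f.HasTemperateGrowth)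
    (r : κ → ι) : Function.HasTemperateGrowth fun z : ι → ℂ => f (z ∘ r) :=
  hf.comp (ContinuousLinearMap.pi fun j => ContinuousLinearMap.proj (R := ℝ) (φ := fun _ : ι => ℂ)
    (r j)).hasTemperateGrowth

lemma Function.HasTemperateGrowth.eval (i : ι) :
    Function.HasTemperateGrowth fun z : ι → ℂ => z i :=
  (ContinuousLinearMap.proj (R := ℝ) (φ := fun _ : ι => ℂ) i).hasTemperateGrowth

lemma Function.HasTemperateGrowth.conj {E : Type*} [NormedAddCommGroup E] [NormedSpace ℝ E]
    {f : E → ℂ} (hf : f.HasTemperateGrowth) : Function.HasTemperateGrowth fun z => conj (f z) :=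
  Complex.conjCLE.toContinuousLinearMap.hasTemperateGrowth.comp hf

end Wirtinger

/-! ### Gaussian integration by parts -/

namespace IsComplexIsonormal

variable {H : Type*} [NormedAddCommGroup H] [InnerProductSpace ℂ H]
  {Ω : Type*} [MeasurableSpace Ω] {P : Measure Ω} {Z : H → Ω → ℂ}
  {ι : Type*} [Fintype ι]

/-- A Gaussian process provides joint laws over finite sets of indices, while `φ` may repeat a
vector; the repetition is a linear map applied to the law over the image. -/
lemma hasGaussianLaw (hZ : IsComplexIsonormal Z P) (φ : ι → H) :
    HasGaussianLaw (fun ω i => Z (φ i) ω) P := by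
  classical
  have h := hZ.gaussian.hasGaussianLaw (Finset.univ.image φ)
  exact h.map_fun (ContinuousLinearMap.pi fun i => ContinuousLinearMap.proj
    (R := ℝ) (φ := fun _ : ↥(Finset.univ.image φ) => ℂ) ⟨φ i, by simp⟩)

lemma memLp_comp (hZ : IsComplexIsonormal Z P) (φ : ι → H) {f : (ι → ℂ) → ℂ}
    (hf : f.HasTemperateGrowth) {p : ℝ≥0∞} (hp : p ≠ ∞) :
    MemLp (fun ω => f fun i => Z (φ i) ω) p P :=
  (hZ.hasGaussianLaw φ).memLp_comp hf hp

lemma integrable_comp (hZ : IsComplexIsonormal Z P) (φ : ι → H) {f : (ι → ℂ) → ℂ}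
    (hf : f.HasTemperateGrowth) : Integrable (fun ω => f fun i => Z (φ i) ω) P :=
  (hZ.hasGaussianLaw φ).integrable_comp hf

lemma memLp (hZ : IsComplexIsonormal Z P) (h : H) {p : ℝ≥0∞} (hp : p ≠ ∞) : MemLp (Z h) p P :=
  (hZ.gaussian.hasGaussianLaw_eval h).memLp hp

lemma integrable_mul (hZ : IsComplexIsonormal Z P) (g h : H) :
    Integrable (fun ω => Z g ω * Z h ω) P :=
  MemLp.integrable_mul (hZ.memLp g (p := 2) (by simp)) (hZ.memLp h (p := 2) (by simp))

lemma integrable_mul_conj (hZ : IsComplexIsonormal Z P) (g h : H) :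
    Integrable (fun ω => Z g ω * conj (Z h ω)) P :=
  MemLp.integrable_mul (hZ.memLp g (p := 2) (by simp)) (hZ.memLp h (p := 2) (by simp)).star

/-- Stein's identity for a real linear functional `l` of `Z h`. -/
lemma integral_real_mul_comp (hZ : IsComplexIsonormal Z P) (φ : ι → H) (h : H)
    {f : (ι → ℂ) → ℂ} (hf : f.HasTemperateGrowth) (l : ℂ →L[ℝ] ℝ) :
    ∫ ω, (l (Z h ω) : ℂ) * f (fun i => Z (φ i) ω) ∂P =
      ∫ ω, fderiv ℝ f (fun i => Z (φ i) ω)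
        (fun i => ∫ ω, (l (Z h ω) : ℂ) * Z (φ i) ω ∂P) ∂P := by
  have hpair : HasGaussianLaw (fun ω => (l (Z h ω), fun i => Z (φ i) ω)) P := by
    -- The extra index `none` carries `h`, which makes `Z h` jointly Gaussian with the `Z (φ i)`.
    have h1 := hZ.hasGaussianLaw (fun o : Option ι => o.elim h φ)
    exact h1.map_fun ((l ∘L ContinuousLinearMap.proj (R := ℝ) (φ := fun _ : Option ι => ℂ)
      none).prod (ContinuousLinearMap.pi fun i => ContinuousLinearMap.proj (some i)))
  have hint : Integrable (Z h) P := (hZ.gaussian.hasGaussianLaw_eval h).integrable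
  have hX : ∫ ω, l (Z h ω) ∂P = 0 := by
    rw [l.integral_comp_comm hint, hZ.mean_zero, map_zero]
  rw [hpair.integral_mul_comp hX hf]
  have hi : Integrable (fun ω => l (Z h ω) • fun i => Z (φ i) ω) P :=
    memLp_one_iff_integrable.1 (hpair.snd.memLp_two.smul (p := 2) hpair.fst.memLp_two)
  have e : ∫ ω, (l (Z h ω) • fun i => Z (φ i) ω) ∂P =
      fun i => ∫ ω, (l (Z h ω) : ℂ) * Z (φ i) ω ∂P := by
    ext i
    have h2 := (ContinuousLinearMap.proj (R := ℝ) (φ := fun _ : ι => ℂ) i).integral_comp_comm hi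
    simpa using h2.symm
  rw [e]

/-- Gaussian integration by parts: `E[conj (Z h) f(Z φ)] = E[∑ ∂_j f(Z φ) ⟨φ_j, h⟩]`. -/
theorem integral_conj_mul_comp (hZ : IsComplexIsonormal Z P) (φ : ι → H) (h : H)
    {f : (ι → ℂ) → ℂ} (hf : f.HasTemperateGrowth) :
    ∫ ω, conj (Z h ω) * f (fun i => Z (φ i) ω) ∂P =
      ∫ ω, wirtingerDir f (fun i => inner ℂ h (φ i)) (fun i => Z (φ i) ω) ∂P := by
  set a : ι → ℂ := fun i => inner ℂ h (φ i) with ha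
  -- Since `E[Z(h) Z(φ_i)] = 0`, the real part of `Z h` has covariances `a / 2` with the `Z (φ i)`,
  -- and the imaginary part `i a / 2`.
  have hre : (fun i => ∫ ω, (Complex.reCLM (Z h ω) : ℂ) * Z (φ i) ω ∂P) = (2⁻¹ : ℝ) • a := by
    ext i
    have e : ∀ ω, (Complex.reCLM (Z h ω) : ℂ) * Z (φ i) ω =
        (2⁻¹ : ℂ) * (Z h ω * Z (φ i) ω + Z (φ i) ω * conj (Z h ω)) := by
      intro ω
      rw [Complex.reCLM_apply, Complex.re_eq_add_conj]
      ring
    simp only [e]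
    rw [integral_const_mul, integral_add (hZ.integrable_mul _ _) (hZ.integrable_mul_conj _ _),
      hZ.relation, hZ.covariance]
    simp [ha]
  have him : (fun i => ∫ ω, (Complex.imCLM (Z h ω) : ℂ) * Z (φ i) ω ∂P) =
      (2⁻¹ : ℝ) • (Complex.I • a) := by
    ext i
    have e : ∀ ω, (Complex.imCLM (Z h ω) : ℂ) * Z (φ i) ω =
        (-(Complex.I / 2)) * (Z h ω * Z (φ i) ω - Z (φ i) ω * conj (Z h ω)) := by
      intro ω
      rw [Complex.imCLM_apply, Complex.im_eq_sub_conj]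
      have := Complex.I_ne_zero
      field_simp
      rw [Complex.I_sq]
      ring
    simp only [e]
    rw [integral_const_mul, integral_sub (hZ.integrable_mul _ _) (hZ.integrable_mul_conj _ _),
      hZ.relation, hZ.covariance]
    simp [ha]
    ring
  have h1 := hZ.integral_real_mul_comp φ h hf Complex.reCLM
  have h2 := hZ.integral_real_mul_comp φ h hf Complex.imCLM
  rw [hre] at h1
  rw [him] at h2
  have hl : ∀ l : ℂ →L[ℝ] ℝ, Integrable
      (fun ω => (l (Z h ω) : ℂ) * f (fun i => Z (φ i) ω)) P := fun l =>
    MemLp.integrable_mul (p := 2) (q := 2)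
      (((hZ.gaussian.hasGaussianLaw_eval h).map_fun (Complex.ofRealCLM ∘L l)).memLp_two)
      (hZ.memLp_comp φ hf (by simp))
  -- Writing `conj = re - i im` combines the two real identities into `(Df(a) - i Df(i a)) / 2`.
  have e : ∀ ω, conj (Z h ω) * f (fun i => Z (φ i) ω) =
      (Complex.reCLM (Z h ω) : ℂ) * f (fun i => Z (φ i) ω) -
      Complex.I * ((Complex.imCLM (Z h ω) : ℂ) * f (fun i => Z (φ i) ω)) := by
    intro ω
    have hc : conj (Z h ω) = ((Z h ω).re : ℂ) - Complex.I * (Z h ω).im := by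
      apply Complex.ext <;> simp
    rw [hc, Complex.reCLM_apply, Complex.imCLM_apply]
    ring
  simp only [e]
  rw [integral_sub (hl _) ((hl _).const_mul _), integral_const_mul, h1, h2, ← integral_const_mul,
    ← integral_sub (hZ.integrable_comp φ (hf.fderiv_apply _))
      ((hZ.integrable_comp φ (hf.fderiv_apply _)).const_mul _)]
  congr with ω
  simp only [wirtingerDir, map_smul, Complex.real_smul]
  push_cast
  ring

end IsComplexIsonormal

/-! ### Total families in Hilbert spaces -/

/-- A family of vectors is total if only `0` is orthogonal to all its members. -/
def IsTotalFamily {ι K : Type*} [NormedAddCommGroup K] [InnerProductSpace ℂ K] (v : ι → K) : Prop :=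
  ∀ x, (∀ i, inner ℂ (v i) x = 0) → x = 0

section Total

variable {ι κ K L : Type*} [NormedAddCommGroup K] [InnerProductSpace ℂ K] [CompleteSpace K]
  [NormedAddCommGroup L] [InnerProductSpace ℂ L]

lemma IsTotalFamily.topologicalClosure_span {v : ι → K} (hv : IsTotalFamily v) :
    (Submodule.span ℂ (Set.range v)).topologicalClosure = ⊤ := by
  rw [Submodule.topologicalClosure_eq_top_iff, Submodule.eq_bot_iff]
  intro x hx
  exact hv x fun i => hx _ (Submodule.subset_span ⟨i, rfl⟩)

/-- A closed subspace containing a total family is everything. -/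
lemma IsTotalFamily.mem_of_isClosed {v : ι → K} (hv : IsTotalFamily v) {S : Submodule ℂ K}
    (hS : IsClosed (S : Set K)) (h : ∀ i, v i ∈ S) (x : K) : x ∈ S := by
  have h1 : (Submodule.span ℂ (Set.range v)).topologicalClosure ≤ S :=
    Submodule.topologicalClosure_minimal _
      (Submodule.span_le.2 (by rintro _ ⟨i, rfl⟩; exact h i)) hS
  exact h1 (hv.topologicalClosure_span ▸ Submodule.mem_top)

lemma IsTotalFamily.clm_ext {M : Type*} [AddCommGroup M] [Module ℂ M] [TopologicalSpace M]
    [T2Space M]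
    {v : ι → K} (hv : IsTotalFamily v) {S T : K →L[ℂ] M}
    (h : ∀ i, S (v i) = T (v i)) : S = T := by
  ext x
  exact hv.mem_of_isClosed (S := LinearMap.eqLocus (S : K →ₗ[ℂ] M) (T : K →ₗ[ℂ] M))
    (isClosed_eq S.continuous T.continuous) h x

/-- Two families with proportional Gram matrices are related by a bounded operator, if the first
is total. -/
lemma IsTotalFamily.exists_clm [CompleteSpace L] {v : ι → K} (hv : IsTotalFamily v)
    (w : ι → L) {c : ℝ} (hc : 0 ≤ c) (h : ∀ i j, inner ℂ (w i) (w j) = c * inner ℂ (v i) (v j)) :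
    ∃ T : K →L[ℂ] L, ∀ i, T (v i) = w i := by
  -- Both families are compared through formal linear combinations: the Gram identity gives `‖f a‖ =
  -- √c ‖e a‖`, so `f` factors through the dense range of `e` and extends.
  set e := Finsupp.linearCombination ℂ v
  set f := Finsupp.linearCombination ℂ w
  have hd : DenseRange e := by
    have h1 := hv.topologicalClosure_span
    rw [← Finsupp.range_linearCombination] at h1
    exact (Submodule.dense_iff_topologicalClosure_eq_top.2 h1 : Dense (LinearMap.range e : Set K))
  have hin : ∀ a, inner ℂ (f a) (f a) = c * inner ℂ (e a) (e a) := by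
    intro a
    simp only [e, f, Finsupp.linearCombination_apply, Finsupp.sum, sum_inner, inner_sum,
      inner_smul_left, inner_smul_right, h, Finset.mul_sum]
    refine Finset.sum_congr rfl fun i _ => Finset.sum_congr rfl fun j _ => ?_
    ring
  have hb : ∀ a, ‖f a‖ ≤ Real.sqrt c * ‖e a‖ := by
    intro a
    have h2 : ‖f a‖ ^ 2 = c * ‖e a‖ ^ 2 := by
      have := hin a
      rw [inner_self_eq_norm_sq_to_K, inner_self_eq_norm_sq_to_K] at this
      apply Complex.ofReal_injective
      push_cast
      exact this
    rw [← Real.sqrt_sq (norm_nonneg (f a)), h2, Real.sqrt_mul hc, Real.sqrt_sq (norm_nonneg _)]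
  refine ⟨f.extendOfNorm e, fun i => ?_⟩
  have h3 := LinearMap.extendOfNorm_eq hd ⟨_, hb⟩ (Finsupp.single i 1)
  simpa [e, f] using h3

end Total

/-! ### Totality in Hilbert tensor products -/

section HTensorTotal

variable {E F : Type*} [NormedAddCommGroup E] [InnerProductSpace ℂ E]
  [NormedAddCommGroup F] [InnerProductSpace ℂ F]

lemma isTotal_htmul : IsTotalFamily fun p : E × F => htmul p.1 p.2 := by
  intro x hx
  have h1 : ∀ t : E ⊗[ℂ] F, inner ℂ (t : HTensor E F) x = 0 := by
    intro t
    induction t using TensorProduct.induction_on with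
    | zero => rw [Completion.coe_zero, inner_zero_left]
    | tmul e f => exact hx (e, f)
    | add s t hs ht => rw [Completion.coe_add, inner_add_left, hs, ht, add_zero]
  have h2 : ∀ y : HTensor E F, inner ℂ y x = 0 := fun y =>
    Completion.induction_on y (isClosed_eq (by fun_prop) (by fun_prop)) h1
  exact inner_self_eq_zero.1 (h2 x)

variable (E F) in
/-- The tensor product as a bounded bilinear map. -/
noncomputable def htmulB : E →L[ℂ] F →L[ℂ] HTensor E F :=
  (ContinuousLinearMap.compL ℂ F (E ⊗[ℂ] F) (HTensor E F) Completion.toComplL).comp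
    (TensorProduct.mkL ℂ E F)

lemma htmulB_apply (e : E) (f : F) : htmulB E F e f = htmul e f := rfl

lemma htmul_smul_left (c : ℂ) (e : E) (f : F) : htmul (c • e) f = c • htmul e f := by
  simp [← htmulB_apply]

lemma htmul_smul_right (c : ℂ) (e : E) (f : F) : htmul e (c • f) = c • htmul e f := by
  simp [← htmulB_apply]

variable [CompleteSpace E] [CompleteSpace F]

/-- One slot is freed at a time: `e ↦ ⟪e ⊗ t j, x⟫` is represented by a vector orthogonal to the
total family `s`, hence zero; likewise in the second slot. -/
lemma IsTotalFamily.htmul {ι κ : Type*} {s : ι → E} {t : κ → F} (hs : IsTotalFamily s)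
    (ht : IsTotalFamily t) :
    IsTotalFamily fun p : ι × κ => htmul (s p.1) (t p.2) := by
  intro x hx
  refine isTotal_htmul x fun p => ?_
  have h1 : ∀ e j, inner ℂ (_root_.htmul e (t j)) x = 0 := by
    intro e j
    have h2 : ContinuousLinearMap.adjoint ((htmulB E F).flip (t j)) x = 0 := by
      refine hs _ fun i => ?_
      rw [ContinuousLinearMap.adjoint_inner_right]
      exact hx (i, j)
    have h3 := ContinuousLinearMap.adjoint_inner_right ((htmulB E F).flip (t j)) e x
    rw [h2, inner_zero_right] at h3
    exact h3.symm
  have h2 : ContinuousLinearMap.adjoint (htmulB E F p.1) x = 0 := by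
    refine ht _ fun j => ?_
    rw [ContinuousLinearMap.adjoint_inner_right]
    exact h1 p.1 j
  have h3 := ContinuousLinearMap.adjoint_inner_right (htmulB E F p.1) p.2 x
  rw [h2, inner_zero_right] at h3
  exact h3.symm

/-- The adjoint of `A ⊗ B` is `A* ⊗ B*`; it is enough to test on elementary tensors. -/
lemma inner_htmul_hmap {E' F' : Type*} [NormedAddCommGroup E'] [InnerProductSpace ℂ E']
    [NormedAddCommGroup F'] [InnerProductSpace ℂ F'] [CompleteSpace E'] [CompleteSpace F']
    (A : E →L[ℂ] E') (B : F →L[ℂ] F') (a : E') (b : F') (x : HTensor E F) :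
    inner ℂ (htmul a b) (hmap A B x) =
      inner ℂ (htmul (ContinuousLinearMap.adjoint A a) (ContinuousLinearMap.adjoint B b)) x := by
  have h : (innerSL ℂ (htmul a b)).comp (hmap A B) =
      innerSL ℂ (htmul (ContinuousLinearMap.adjoint A a) (ContinuousLinearMap.adjoint B b)) := by
    refine isTotal_htmul.clm_ext fun p => ?_
    simp [hmap_htmul, inner_htmul, ContinuousLinearMap.adjoint_inner_left]
  exact congrArg (fun S => S x) h

end HTensorTotal

/-! ### Symmetric powers -/

section SymPower

variable {H : Type u} [NormedAddCommGroup H] [InnerProductSpace ℂ H]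

instance (k : ℕ) : CompleteSpace (SymPow H k) :=
  (Submodule.isClosed_topologicalClosure _).completeSpace_coe

lemma inner_elemTensor (k : ℕ) (a b : Fin k → H) :
    inner ℂ (elemTensor k a) (elemTensor k b) = ∏ i, inner ℂ (a i) (b i) := by
  induction k with
  | zero =>
    have : inner ℂ (EuclideanSpace.single PUnit.unit 1 : EuclideanSpace ℂ PUnit.{u + 1})
        (EuclideanSpace.single PUnit.unit 1 : EuclideanSpace ℂ PUnit.{u + 1}) = 1 := by simp
    rw [Fin.prod_univ_zero]
    exact this
  | succ k ih =>
    rw [Fin.prod_univ_succ]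
    have := inner_htmul (a 0) (b 0) (elemTensor k (Fin.tail a)) (elemTensor k (Fin.tail b))
    rw [ih] at this
    exact this

lemma inner_symPower (k : ℕ) (g h : H) :
    inner ℂ (symPower k g) (symPower k h) = inner ℂ g h ^ k := by
  rw [Submodule.coe_inner]
  simp [symPower, inner_elemTensor]

lemma contractPow_elemTensor_const (k : ℕ) (g h : H) :
    contractPow k g (elemTensor (k + 1) fun _ => h) = inner ℂ g h • elemTensor k fun _ => h := by
  have h1 := contractPow_elemTensor k g (fun _ => h)
  have h2 : Fin.tail (fun _ : Fin (k + 1) => h) = fun _ => h := rfl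
  rw [h2] at h1
  exact h1

lemma coe_contractSym_symPower (k : ℕ) (g h : H) :
    (contractSym k g (symPower (k + 1) h) : TensorPow H k) =
      contractPow k g (elemTensor (k + 1) fun _ => h) := rfl

lemma contractSym_symPower (k : ℕ) (g h : H) : contractSym k g (symPower (k + 1) h) =
    inner ℂ g h • symPower k h := by
  apply Subtype.ext
  rw [coe_contractSym_symPower, contractPow_elemTensor_const]
  rfl

/-- The derivative of `h ↦ h^{⊗k}` at `h` in the direction `g`. -/
noncomputable def powDeriv : (k : ℕ) → (h g : H) → TensorPow H k
  | 0, _, _ => 0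
  | k + 1, h, g => (htmul h (powDeriv k h g) + htmul g (elemTensor k fun _ => h) :
      HTensor H (TensorPow H k))

lemma powDeriv_smul (k : ℕ) (c : ℂ) (h g : H) : powDeriv k h (c • g) = c • powDeriv k h g := by
  induction k with
  | zero => simp [powDeriv]
  | succ k ih =>
    have : (htmul h (powDeriv k h (c • g)) + htmul (c • g) (elemTensor k fun _ => h) :
      HTensor H (TensorPow H k)) =
      c • (htmul h (powDeriv k h g) + htmul g (elemTensor k fun _ => h)) := by
      rw [ih, htmul_smul_left, htmul_smul_right, smul_add]
    exact this

lemma hasDerivAt_add_smul (h g : H) :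
    HasDerivAt (fun t : ℝ => h + (t : ℂ) • g) g 0 := by
  have h1 : HasDerivAt (fun t : ℝ => (t : ℂ)) 1 0 := Complex.ofRealCLM.hasDerivAt
  simpa using (h1.smul_const g).const_add h

lemma hasDerivAt_elemTensor (k : ℕ) (h g : H) :
    HasDerivAt (fun t : ℝ => elemTensor k fun _ => h + (t : ℂ) • g) (powDeriv k h g) 0 := by
  induction k with
  | zero => exact hasDerivAt_const _ _
  | succ k ih =>
    have h1 := ((htmulB H (TensorPow H k)).bilinearRestrictScalars ℝ).hasDerivAt_of_bilinear
      (fun _ => hasDerivAt_add_smul h g) (fun _ => ih)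
    simp only [ContinuousLinearMap.bilinearRestrictScalars_apply_apply, htmulB_apply,
      Complex.ofReal_zero, zero_smul, add_zero] at h1
    exact h1

/-- A constant tensor does not see the order of the factors, so all `k!` terms of the symmetrization
agree. -/
lemma inner_elemTensor_symElem (k : ℕ) (h : H) (κ : Fin k → H) :
    inner ℂ (elemTensor k fun _ => h) (symElem k κ) = ∏ i, inner ℂ h (κ i) := by
  have h0 : ((k.factorial : ℂ)) ≠ 0 := by exact_mod_cast k.factorial_ne_zero
  have h1 : ∀ σ : Equiv.Perm (Fin k), ∏ i, inner ℂ h ((κ ∘ σ) i) = ∏ i, inner ℂ h (κ i) :=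
    fun σ => Equiv.prod_comp σ fun i => inner ℂ h (κ i)
  rw [symElem, inner_smul_right, inner_sum]
  simp only [inner_elemTensor, h1]
  rw [Finset.sum_const, Finset.card_univ, Fintype.card_perm, Fintype.card_fin, nsmul_eq_mul,
    inv_mul_cancel_left₀ h0]

/-- The map `i ↦ swap 0 p i.succ` enumerates the indices other than `p`; it is the form in which
`decomposeFin` describes permutations sending `0` to `p`. -/
lemma prod_swap_succ {k : ℕ} (p : Fin (k + 1)) (f : Fin (k + 1) → ℂ) :
    ∏ i : Fin k, f (Equiv.swap 0 p i.succ) = ∏ j ∈ Finset.univ.erase p, f j := by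
  have h : Finset.univ.erase p = Finset.univ.image fun i : Fin k => Equiv.swap 0 p i.succ := by
    ext j
    simp only [Finset.mem_erase, Finset.mem_univ, and_true, Finset.mem_image, true_and]
    constructor
    · intro hj
      have h1 : Equiv.swap 0 p j ≠ 0 := by
        intro h2
        apply hj
        rw [← Equiv.swap_apply_self 0 p j, h2, Equiv.swap_apply_left]
      obtain ⟨i, hi⟩ := Fin.exists_succ_eq.2 h1
      exact ⟨i, by rw [hi, Equiv.swap_apply_self]⟩
    · rintro ⟨i, rfl⟩ h2
      have h3 : i.succ = Equiv.swap 0 p p := by nth_rw 2 [← h2]; rw [Equiv.swap_apply_self]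
      rw [Equiv.swap_apply_right] at h3
      exact Fin.succ_ne_zero i h3
  rw [h, Finset.prod_image]
  intro i _ j _ hij
  exact Fin.succ_injective _ ((Equiv.swap 0 p).injective hij)

/-- Sort the permutations by the image `p` of `0`: each `p` occurs `k!` times out of `(k+1)!`, which
the factor `k + 1` compensates. -/
lemma inner_elemTensor_contractPow_symElem (k : ℕ) (h g : H) (κ : Fin (k + 1) → H) :
    ((k + 1 : ℕ) : ℂ) * inner ℂ (elemTensor k fun _ => h) (contractPow k g (symElem (k + 1) κ)) =
      ∑ p, (∏ j ∈ Finset.univ.erase p, inner ℂ h (κ j)) * inner ℂ g (κ p) := by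
  have h0 : ((k.factorial : ℂ)) ≠ 0 := by exact_mod_cast k.factorial_ne_zero
  have h1 : ((k + 1 : ℕ) : ℂ) ≠ 0 := by exact_mod_cast k.succ_ne_zero
  have key : ∀ (p : Fin (k + 1)) (e : Equiv.Perm (Fin k)),
      inner ℂ (elemTensor k fun _ => h) (contractPow k g
        (elemTensor (k + 1) (κ ∘ Equiv.Perm.decomposeFin.symm (p, e)))) =
        (∏ j ∈ Finset.univ.erase p, inner ℂ h (κ j)) * inner ℂ g (κ p) := by
    intro p e
    rw [contractPow_elemTensor, inner_smul_right, inner_elemTensor, mul_comm,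
      ← prod_swap_succ p fun j => inner ℂ h (κ j),
      ← Equiv.prod_comp e fun i : Fin k => inner ℂ h (κ (Equiv.swap 0 p i.succ))]
    congr 2
    · ext i
      simp [Fin.tail]
    · simp
  rw [symElem, map_smul, map_sum, inner_smul_right, inner_sum,
    ← Equiv.sum_comp Equiv.Perm.decomposeFin.symm, Fintype.sum_prod_type]
  simp only [key, Finset.sum_const, Finset.card_univ, Fintype.card_perm, Fintype.card_fin,
    nsmul_eq_mul]
  rw [← Finset.mul_sum, Nat.factorial_succ]
  push_cast at h1 ⊢
  field_simp

/-- Both sides are continuous in `x`, so symmetrized elementary tensors suffice; there both are the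
derivative at `0` of `∏ ⟪h + t g, κ i⟫`. -/
lemma inner_powDeriv (k : ℕ) (h g : H) {x : TensorPow H (k + 1)} (hx : x ∈ SymPow H (k + 1)) :
    inner ℂ (powDeriv (k + 1) h g) x =
      ((k + 1 : ℕ) : ℂ) * inner ℂ (elemTensor k fun _ => h) (contractPow k g x) := by
  let A : TensorPow H (k + 1) →L[ℂ] ℂ := innerSL ℂ (powDeriv (k + 1) h g)
  let B : TensorPow H (k + 1) →L[ℂ] ℂ :=
    ((k + 1 : ℕ) : ℂ) • (innerSL ℂ (elemTensor k fun _ => h)).comp (contractPow k g)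
  have hle : SymPow H (k + 1) ≤ LinearMap.eqLocus (A : TensorPow H (k + 1) →ₗ[ℂ] ℂ)
      (B : TensorPow H (k + 1) →ₗ[ℂ] ℂ) := by
    refine Submodule.topologicalClosure_minimal _ ?_ (isClosed_eq A.continuous B.continuous)
    rw [Submodule.span_le]
    rintro _ ⟨κ, rfl⟩
    change inner ℂ (powDeriv (k + 1) h g) (symElem (k + 1) κ) =
      ((k + 1 : ℕ) : ℂ) * inner ℂ (elemTensor k fun _ => h) (contractPow k g (symElem (k + 1) κ))
    rw [inner_elemTensor_contractPow_symElem]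
    have h1 : HasDerivAt (fun t : ℝ => inner ℂ (elemTensor (k + 1) fun _ => h + (t : ℂ) • g)
        (symElem (k + 1) κ)) (inner ℂ (powDeriv (k + 1) h g) (symElem (k + 1) κ)) 0 := by
      simpa using (hasDerivAt_elemTensor (k + 1) h g).inner ℂ (hasDerivAt_const 0 (symElem (k + 1) κ))
    simp only [inner_elemTensor_symElem] at h1
    have h2 : HasDerivAt (fun t : ℝ => ∏ i, inner ℂ (h + (t : ℂ) • g) (κ i))
        (∑ p, (∏ j ∈ Finset.univ.erase p, inner ℂ h (κ j)) * inner ℂ g (κ p)) 0 := by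
      have h3 := HasDerivAt.fun_finsetProd (u := Finset.univ)
        (f := fun (i : Fin (k + 1)) (t : ℝ) => inner ℂ (h + (t : ℂ) • g) (κ i))
        (f' := fun i => inner ℂ g (κ i)) (x := 0) fun i _ => by
          simpa only [inner_zero_right, zero_add] using
            (hasDerivAt_add_smul h g).inner ℂ (hasDerivAt_const 0 (κ i))
      simpa using h3
    exact h1.unique h2
  exact hle hx

/-- The derivative of `h ↦ h^{⊗k}` in the symmetric power. -/
noncomputable def symDeriv (k : ℕ) (h g : H) : SymPow H k :=
  (SymPow H k).orthogonalProjectionOnto (powDeriv k h g)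

lemma symDeriv_smul (k : ℕ) (c : ℂ) (h g : H) : symDeriv k h (c • g) = c • symDeriv k h g := by
  rw [symDeriv, powDeriv_smul, map_smul, symDeriv]

/-- Turns orthogonality to the derivative of `h^{⊗(k+1)}` into orthogonality of a contraction to
`h^{⊗k}`, which drives the induction on the degree. -/
lemma symDeriv_succ (k : ℕ) (h g : H) : symDeriv (k + 1) h g =
    ((k + 1 : ℕ) : ℂ) • ContinuousLinearMap.adjoint (contractSym k g) (symPower k h) := by
  refine ext_inner_right ℂ fun x => ?_
  rw [symDeriv, Submodule.inner_orthogonalProjectionOnto_eq_of_mem_right, inner_powDeriv k h g x.2,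
    inner_smul_left, ContinuousLinearMap.adjoint_inner_left, Submodule.coe_inner, map_natCast]
  rfl

/-- The orthogonal projection fixes the powers, so it may be applied before differentiating. -/
lemma hasDerivAt_symPower (k : ℕ) (h g : H) :
    HasDerivAt (fun t : ℝ => symPower k (h + (t : ℂ) • g)) (symDeriv k h g) 0 := by
  have h1 := ((SymPow H k).orthogonalProjectionOnto.restrictScalars ℝ).hasFDerivAt.comp_hasDerivAt
    (0 : ℝ) (hasDerivAt_elemTensor k h g)
  have h2 : ∀ t : ℝ, symPower k (h + (t : ℂ) • g) =
      (SymPow H k).orthogonalProjectionOnto (elemTensor k fun _ => h + (t : ℂ) • g) := fun t =>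
    ((SymPow H k).orthogonalProjectionOnto_mem_subspace_eq_self
      (symPower k (h + (t : ℂ) • g))).symm
  simp only [h2]
  exact h1

/-- A vector orthogonal to the family has vanishing contractions, hence is orthogonal to every `g ⊗
y` in `H ⊗ H^{⊗k}`. -/
lemma isTotal_adjoint_contractSym (k : ℕ) : IsTotalFamily fun p : H × SymPow H k =>
    ContinuousLinearMap.adjoint (contractSym k p.1) p.2 := by
  intro x hx
  have h1 : ∀ g : H, contractSym k g x = 0 := by
    intro g
    refine ext_inner_left ℂ fun a => ?_
    rw [inner_zero_right, ← ContinuousLinearMap.adjoint_inner_left]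
    exact hx (g, a)
  refine Subtype.ext ?_
  refine isTotal_htmul (E := H) (F := TensorPow H k) _ fun p => ?_
  have h2 : contractPow k p.1 (x : TensorPow H (k + 1)) = 0 := congrArg Subtype.val (h1 p.1)
  have h3 := ContinuousLinearMap.adjoint_inner_right (htmulL (F := TensorPow H k) p.1) p.2
    (x : TensorPow H (k + 1))
  exact h3.symm.trans ((congrArg _ h2).trans (inner_zero_right _))

lemma EuclideanSpace.eq_zero_of_inner_single {y : EuclideanSpace ℂ PUnit.{u + 1}}
    (h : inner ℂ (EuclideanSpace.single PUnit.unit (1 : ℂ)) y = 0) : y = 0 := by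
  refine PiLp.ext fun i => ?_
  rw [EuclideanSpace.inner_single_left] at h
  simpa using h

lemma isTotal_symPow_zero : IsTotalFamily fun _ : Unit => symPower 0 (0 : H) := fun _ hx =>
  Subtype.ext (EuclideanSpace.eq_zero_of_inner_single (hx ()))

end SymPower

/-! ### Diagonal tensors are total -/

section Diagonal

variable {H : Type u} [NormedAddCommGroup H] [InnerProductSpace ℂ H]

/-- The diagonal tensor `h^{⊗m} ⊗ (conj h)^{⊗n}`. -/
noncomputable def diagTensor (cj : H ≃ₗᵢ⋆[ℂ] H) (m n : ℕ) (h : H) : KernelSp H m n :=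
  htmul (symPower m h) (symPower n (cj h))

variable {cj : H ≃ₗᵢ⋆[ℂ] H} {m n : ℕ}

lemma inner_diagTensor (g h : H) : inner ℂ (diagTensor cj m n g) (diagTensor cj m n h) =
    inner ℂ g h ^ m * inner ℂ (cj g) (cj h) ^ n := by
  rw [diagTensor, diagTensor, inner_htmul, inner_symPower, inner_symPower]

lemma sliceLeft_diagTensor (g h : H) : sliceLeft m n g (diagTensor cj (m + 1) n h) =
    inner ℂ g h • diagTensor cj m n h := by
  rw [sliceLeft, diagTensor, hmap_htmul, contractSym_symPower, htmul_smul_left]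
  rfl

lemma sliceRight_diagTensor (g h : H) : sliceRight m n g (diagTensor cj m (n + 1) h) =
    inner ℂ g (cj h) • diagTensor cj m n h := by
  rw [sliceRight, diagTensor, hmap_htmul, contractSym_symPower, htmul_smul_right]
  rfl

/-- The derivative of the diagonal tensor is a sum of one term linear and one antilinear in `g`, so
the directions `g` and `i g` determine each separately. -/
lemma inner_diagTensor_deriv {x : KernelSp H m n} (hx : ∀ h, inner ℂ (diagTensor cj m n h) x = 0)
    (h g : H) :
    inner ℂ (htmul (symDeriv m h g) (symPower n (cj h))) x = 0 ∧
      inner ℂ (htmul (symPower m h) (symDeriv n (cj h) (cj g))) x = 0 := by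
  have key : ∀ g, inner ℂ (htmul (symPower m h) (symDeriv n (cj h) (cj g))) x +
      inner ℂ (htmul (symDeriv m h g) (symPower n (cj h))) x = 0 := by
    intro g
    have h1 := ((htmulB (SymPow H m) (SymPow H n)).bilinearRestrictScalars ℝ).hasDerivAt_of_bilinear
      (fun _ => hasDerivAt_symPower m h g) (fun _ => hasDerivAt_symPower n (cj h) (cj g))
    have h2 := h1.inner ℂ (hasDerivAt_const 0 x)
    have h3 : ∀ t : ℝ, inner ℂ ((((htmulB (SymPow H m) (SymPow H n)).bilinearRestrictScalars ℝ)
        (symPower m (h + (t : ℂ) • g))) (symPower n (cj h + (t : ℂ) • cj g))) x = 0 := by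
      intro t
      have h4 := hx (h + (t : ℂ) • g)
      rw [diagTensor, map_add, map_smulₛₗ, Complex.conj_ofReal] at h4
      exact h4
    simp only [h3] at h2
    have h5 := h2.unique (hasDerivAt_const 0 0)
    simp only [ContinuousLinearMap.bilinearRestrictScalars_apply_apply, htmulB_apply,
      Complex.ofReal_zero, zero_smul, add_zero, inner_zero_right, zero_add, inner_add_left] at h5
    exact h5
  have h1 := key g
  have h2 := key (Complex.I • g)
  rw [map_smulₛₗ, symDeriv_smul, symDeriv_smul, htmul_smul_left, htmul_smul_right,
    inner_smul_left, inner_smul_left] at h2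
  simp only [Complex.conj_I, map_neg, neg_neg] at h2
  have hI := Complex.I_ne_zero
  have h3 : inner ℂ (htmul (symPower m h) (symDeriv n (cj h) (cj g))) x -
      inner ℂ (htmul (symDeriv m h g) (symPower n (cj h))) x = 0 := by
    have : Complex.I * (inner ℂ (htmul (symPower m h) (symDeriv n (cj h) (cj g))) x -
      inner ℂ (htmul (symDeriv m h g) (symPower n (cj h))) x) = 0 := by
      linear_combination h2
    exact (mul_eq_zero.1 this).resolve_left hI
  constructor
  · linear_combination (h1 - h3) / 2
  · linear_combination (h1 + h3) / 2

/-- The diagonal tensors `h^{⊗m} ⊗ (conj h)^{⊗n}` span a dense subspace. -/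
theorem isTotal_diagTensor (cj : H ≃ₗᵢ⋆[ℂ] H) (m n : ℕ) : IsTotalFamily (diagTensor cj m n) := by
  induction m with
  | zero =>
    induction n with
    | zero =>
      intro x hx
      refine (isTotal_symPow_zero.htmul isTotal_symPow_zero) x fun _ => ?_
      have := hx 0
      rwa [diagTensor, map_zero] at this
    | succ n ih =>
      intro x hx
      -- The slices of `x` are orthogonal to the diagonal tensors of degree `n`. With `m = 0` the
      -- left slot is one-dimensional, so vanishing right slices force `x = 0`; every vector of `H`
      -- is some `cj g`.
      have h1 : ∀ g, sliceRight 0 n (cj g) x = 0 := by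
        refine fun g => ih _ fun h => ?_
        have h2 := (inner_diagTensor_deriv hx h g).2
        rw [symDeriv_succ, htmul_smul_right, inner_smul_left] at h2
        have h3 := (mul_eq_zero.1 h2).resolve_left (by
          rw [map_natCast]; exact_mod_cast n.succ_ne_zero)
        rw [sliceRight, diagTensor, inner_htmul_hmap, ContinuousLinearMap.adjoint_id]
        exact h3
      refine (isTotal_symPow_zero.htmul (isTotal_adjoint_contractSym n)) x fun p => ?_
      obtain ⟨g, hg⟩ := cj.surjective p.2.1
      have h2 := inner_htmul_hmap (ContinuousLinearMap.id ℂ (SymPow H 0)) (contractSym n p.2.1)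
        (symPower 0 0) p.2.2 x
      have h3 : hmap (ContinuousLinearMap.id ℂ (SymPow H 0)) (contractSym n p.2.1) x = 0 :=
        hg ▸ h1 g
      rw [h3, inner_zero_right, ContinuousLinearMap.adjoint_id] at h2
      exact h2.symm
  | succ m ih =>
    intro x hx
    -- By the left half of the derivative, all left slices of `x` are orthogonal to the diagonal
    -- tensors of bidegree `(m, n)`.
    have h1 : ∀ g, sliceLeft m n g x = 0 := by
      refine fun g => ih _ fun h => ?_
      have h2 := (inner_diagTensor_deriv hx h g).1
      rw [symDeriv_succ, htmul_smul_left, inner_smul_left] at h2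
      have h3 := (mul_eq_zero.1 h2).resolve_left (by
        rw [map_natCast]; exact_mod_cast m.succ_ne_zero)
      rw [sliceLeft, diagTensor, inner_htmul_hmap, ContinuousLinearMap.adjoint_id]
      exact h3
    have hid : IsTotalFamily fun b : SymPow H n => b := fun x hx => inner_self_eq_zero.1 (hx x)
    refine ((isTotal_adjoint_contractSym m).htmul hid) x fun p => ?_
    have h2 := inner_htmul_hmap (contractSym m p.1.1) (ContinuousLinearMap.id ℂ (SymPow H n))
      p.1.2 p.2 x
    have h3 : hmap (contractSym m p.1.1) (ContinuousLinearMap.id ℂ (SymPow H n)) x = 0 := h1 p.1.1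
    rw [h3, inner_zero_right, ContinuousLinearMap.adjoint_id] at h2
    exact h2.symm

end Diagonal

/-! ### Complex Hermite polynomials -/

section Hermite

/-- The additional terms carry a zero binomial coefficient; a freely chosen range lets polynomials
of different degrees be compared term by term. -/
lemma complexHermite_eq_sum_range (m n N : ℕ) (hN : min m n < N) (z : ℂ) (ρ : ℝ) :
    complexHermite m n z ρ = ∑ k ∈ Finset.range N,
      (-1) ^ k * (k.factorial : ℂ) * (m.choose k : ℂ) * (n.choose k : ℂ) *
        z ^ (m - k) * (conj z) ^ (n - k) * (ρ : ℂ) ^ k := by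
  rw [complexHermite]
  refine Finset.sum_subset (Finset.range_subset_range.2 hN) fun k _ hk => ?_
  rw [Finset.mem_range, not_lt, Nat.succ_le_iff, min_lt_iff] at hk
  rcases hk with hk | hk <;> simp [Nat.choose_eq_zero_of_lt hk]

lemma conj_complexHermite (m n : ℕ) (z : ℂ) (ρ : ℝ) :
    conj (complexHermite m n z ρ) = complexHermite n m z ρ := by
  rw [complexHermite, complexHermite, map_sum, min_comm]
  refine Finset.sum_congr rfl fun k _ => ?_
  simp only [map_mul, map_pow, map_neg, map_one, map_natCast, Complex.conj_conj,
    Complex.conj_ofReal]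
  ring

lemma complexHermite_conj (m n : ℕ) (z : ℂ) (ρ : ℝ) :
    complexHermite m n (conj z) ρ = complexHermite n m z ρ := by
  rw [complexHermite, complexHermite, min_comm]
  refine Finset.sum_congr rfl fun k _ => ?_
  simp only [Complex.conj_conj]
  ring

lemma complexHermite_zero_zero (z : ℂ) (ρ : ℝ) : complexHermite 0 0 z ρ = 1 := by
  simp [complexHermite]

lemma complexHermite_succ_zero (m : ℕ) (z : ℂ) (ρ : ℝ) :
    complexHermite (m + 1) 0 z ρ = z * complexHermite m 0 z ρ := by
  simp [complexHermite, pow_succ']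

/-- Pascal's rule in `m`, and `(n+1) C(n,k) = (k+1) C(n+1,k+1)` for the part with index shifted by
one. The recursion identifies the divergence of `J_{m,n}(Z h) h`. -/
lemma complexHermite_succ_succ (m n : ℕ) (z : ℂ) (ρ : ℝ) :
    complexHermite (m + 1) (n + 1) z ρ = z * complexHermite m (n + 1) z ρ -
      ((n + 1 : ℕ) : ℂ) * ρ * complexHermite m n z ρ := by
  rw [complexHermite_eq_sum_range (m + 1) (n + 1) (n + 2) (by omega),
    complexHermite_eq_sum_range m (n + 1) (n + 2) (by omega),
    complexHermite_eq_sum_range m n (n + 1) (by omega),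
    Finset.sum_range_succ', Finset.sum_range_succ' _ (n + 1), mul_add, Finset.mul_sum,
    Finset.mul_sum, add_sub_right_comm, ← Finset.sum_sub_distrib]
  congr 1
  · refine Finset.sum_congr rfl fun k _ => ?_
    have h1 : ((n : ℂ) + 1) * (n.choose k : ℂ) = ((n + 1).choose (k + 1) : ℂ) * (k + 1) := by
      exact_mod_cast Nat.add_one_mul_choose_eq n k
    have h2 : ((m + 1).choose (k + 1) : ℂ) = (m.choose k : ℂ) + (m.choose (k + 1) : ℂ) := by
      exact_mod_cast Nat.choose_succ_succ m k
    -- For `k ≥ m` the truncated exponents would disagree, but the binomial coefficient vanishes.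
    have h3 : (m.choose (k + 1) : ℂ) * z ^ (m - k) =
        (m.choose (k + 1) : ℂ) * (z * z ^ (m - (k + 1))) := by
      rcases lt_or_ge k m with h | h
      · rw [← pow_succ', show m - (k + 1) + 1 = m - k by omega]
      · simp [Nat.choose_eq_zero_of_lt (show m < k + 1 by omega)]
    rw [Nat.factorial_succ, h2, show m + 1 - (k + 1) = m - k by omega,
      show n + 1 - (k + 1) = n - k by omega]
    push_cast
    set A := (-1 : ℂ) ^ k * (k.factorial : ℂ) * (conj z) ^ (n - k) * (ρ : ℂ) ^ (k + 1)
    have e1 : (-1 : ℂ) ^ (k + 1) * (((k : ℂ) + 1) * (k.factorial : ℂ)) *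
        ((m.choose k : ℂ) + (m.choose (k + 1) : ℂ)) * ((n + 1).choose (k + 1) : ℂ) *
        z ^ (m - k) * (conj z) ^ (n - k) * (ρ : ℂ) ^ (k + 1) =
        -A * (m.choose k : ℂ) * z ^ (m - k) * (((n + 1).choose (k + 1) : ℂ) * (k + 1)) -
        A * ((m.choose (k + 1) : ℂ) * z ^ (m - k)) * ((n + 1).choose (k + 1) : ℂ) * (k + 1) := by
      simp only [A]
      ring
    rw [e1, h3, ← h1]
    simp only [A]
    ring
  · simp [pow_succ']
    ring

variable {ι : Type*} [Fintype ι]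

lemma wirtingerDir_const (c : ℂ) (a y : ι → ℂ) : wirtingerDir (fun _ => c) a y = 0 := by
  simp [wirtingerDir]

lemma wirtingerDir_sum {κ : Type*} (s : Finset κ) {f : κ → (ι → ℂ) → ℂ} {y : ι → ℂ}
    (hf : ∀ k ∈ s, DifferentiableAt ℝ (f k) y) (a : ι → ℂ) :
    wirtingerDir (fun z => ∑ k ∈ s, f k z) a y = ∑ k ∈ s, wirtingerDir (f k) a y := by
  simp only [wirtingerDir]
  rw [fderiv_fun_sum hf]
  simp only [_root_.sum_apply]
  rw [Finset.mul_sum, ← Finset.sum_sub_distrib, Finset.sum_div]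

lemma differentiable_eval (i : ι) : Differentiable ℝ fun z : ι → ℂ => z i :=
  (Function.HasTemperateGrowth.eval i).differentiable

lemma differentiable_conj_eval (i : ι) : Differentiable ℝ fun z : ι → ℂ => conj (z i) :=
  (Function.HasTemperateGrowth.eval i).conj.differentiable

lemma wirtingerDir_eval (i : ι) (a y : ι → ℂ) : wirtingerDir (fun z => z i) a y = a i := by
  have h : HasFDerivAt (fun z : ι → ℂ => z i)
    (ContinuousLinearMap.proj (R := ℝ) (φ := fun _ : ι => ℂ) i) y :=
    (ContinuousLinearMap.proj (R := ℝ) (φ := fun _ : ι => ℂ) i).hasFDerivAt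
  rw [wirtingerDir, h.fderiv]
  simp only [ContinuousLinearMap.proj_apply, Pi.smul_apply, smul_eq_mul]
  linear_combination (-a i / 2) * Complex.I_sq

lemma wirtingerDir_conj_eval (i : ι) (a y : ι → ℂ) :
    wirtingerDir (fun z => conj (z i)) a y = 0 := by
  have h : HasFDerivAt (fun z : ι → ℂ => conj (z i))
    (Complex.conjCLE.toContinuousLinearMap ∘L
      ContinuousLinearMap.proj (R := ℝ) (φ := fun _ : ι => ℂ) i) y :=
    (Complex.conjCLE.toContinuousLinearMap ∘L
      ContinuousLinearMap.proj (R := ℝ) (φ := fun _ : ι => ℂ) i).hasFDerivAt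
  rw [wirtingerDir, h.fderiv]
  simp only [ContinuousLinearMap.comp_apply, ContinuousLinearMap.proj_apply, Pi.smul_apply,
    smul_eq_mul, ContinuousLinearEquiv.coe_coe, Complex.conjCLE_apply, map_mul, Complex.conj_I]
  linear_combination (conj (a i) / 2) * Complex.I_sq

lemma wirtingerDir_pow {f : (ι → ℂ) → ℂ} {y : ι → ℂ} (hf : DifferentiableAt ℝ f y) (p : ℕ)
    (a : ι → ℂ) : wirtingerDir (fun z => f z ^ p) a y =
      (p : ℂ) * f y ^ (p - 1) * wirtingerDir f a y := by
  simp only [wirtingerDir]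
  rw [fderiv_fun_pow p hf]
  simp
  ring

lemma hasTemperateGrowth_complexHermite (m n : ℕ) (ρ : ℝ) (i : ι) :
    Function.HasTemperateGrowth fun y : ι → ℂ => complexHermite m n (y i) ρ := by
  refine Function.HasTemperateGrowth.sum fun k _ => ?_
  have h1 := Function.HasTemperateGrowth.eval i
  exact (((Function.HasTemperateGrowth.const _).mul (h1.pow _)).mul (h1.conj.pow _)).mul
    (Function.HasTemperateGrowth.const _)

lemma wirtingerDir_hermite_term (c d : ℂ) (p q : ℕ) (i : ι) (a y : ι → ℂ) :
    wirtingerDir (fun z => c * z i ^ p * conj (z i) ^ q * d) a y =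
      c * ((p : ℂ) * y i ^ (p - 1)) * conj (y i) ^ q * d * a i := by
  have h1 := (differentiable_eval (ι := ι) i) y
  have h2 := (differentiable_conj_eval (ι := ι) i) y
  have hc : ∀ c : ℂ, DifferentiableAt ℝ (fun _ : ι → ℂ => c) y := fun c =>
    differentiableAt_const c
  have h3 := (hc c).fun_mul (h1.fun_pow p)
  have h4 := h3.fun_mul (h2.fun_pow q)
  rw [wirtingerDir_mul h4 (hc d), wirtingerDir_mul h3 (h2.fun_pow q),
    wirtingerDir_mul (hc c) (h1.fun_pow p), wirtingerDir_pow h1, wirtingerDir_pow h2,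
    wirtingerDir_const, wirtingerDir_const, wirtingerDir_eval, wirtingerDir_conj_eval]
  ring

lemma wirtingerDir_complexHermite_zero (n : ℕ) (ρ : ℝ) (i : ι) (a y : ι → ℂ) :
    wirtingerDir (fun y => complexHermite 0 n (y i) ρ) a y = 0 := by
  simp only [complexHermite]
  rw [wirtingerDir_sum]
  · simp only [wirtingerDir_hermite_term]
    simp
  · intro k _
    have h1 := Function.HasTemperateGrowth.eval i
    exact ((((Function.HasTemperateGrowth.const _).mul (h1.pow _)).mul (h1.conj.pow _)).mul
      (Function.HasTemperateGrowth.const _)).differentiable y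

/-- Termwise, `(m+1-k) C(m+1,k) = (m+1) C(m,k)`; the powers of `conj z` are annihilated by `∂_z`. -/
lemma wirtingerDir_complexHermite_succ (m n : ℕ) (ρ : ℝ) (i : ι) (a y : ι → ℂ) :
    wirtingerDir (fun y => complexHermite (m + 1) n (y i) ρ) a y =
      ((m + 1 : ℕ) : ℂ) * complexHermite m n (y i) ρ * a i := by
  simp only [complexHermite_eq_sum_range (m + 1) n (n + 1) (by omega),
    complexHermite_eq_sum_range m n (n + 1) (by omega)]
  rw [wirtingerDir_sum]
  · simp only [wirtingerDir_hermite_term]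
    rw [Finset.mul_sum, Finset.sum_mul]
    refine Finset.sum_congr rfl fun k _ => ?_
    have h1 : ((m + 1).choose k : ℂ) * ((m + 1 - k : ℕ) : ℂ) = (m.choose k : ℂ) * (m + 1) := by
      exact_mod_cast (Nat.choose_mul_succ_eq m k).symm
    rw [show m + 1 - k - 1 = m - k by omega]
    push_cast
    linear_combination ((-1) ^ k * (k.factorial : ℂ) * (n.choose k : ℂ) * y i ^ (m - k) *
      conj (y i) ^ (n - k) * (ρ : ℂ) ^ k * a i) * h1
  · intro k _
    have h1 := Function.HasTemperateGrowth.eval i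
    exact ((((Function.HasTemperateGrowth.const _).mul (h1.pow _)).mul (h1.conj.pow _)).mul
      (Function.HasTemperateGrowth.const _)).differentiable y

end Hermite

/-! ### Smooth random variables are dense -/

section Density

variable {H : Type u} [NormedAddCommGroup H] [InnerProductSpace ℂ H]
  {Ω : Type v} [MeasurableSpace Ω] {P : Measure Ω} {Z : H → Ω → ℂ}

/-- Schwartz functions have temperate growth and are dense in `L²` of the law of `Y`, so `G` is
orthogonal to every square integrable function of `Y`, in particular to indicators. -/
lemma IsComplexIsonormal.setIntegral_preimage_eq_zero [IsProbabilityMeasure P]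
    (hZ : IsComplexIsonormal Z P) (G : Lp ℂ 2 P)
    (hG : ∀ (k : ℕ) (f : (Fin k → ℂ) → ℂ) (φ : Fin k → H) (F : Lp ℂ 2 P),
      Function.HasTemperateGrowth f → (∀ᵐ ω ∂P, F ω = f fun i => Z (φ i) ω) → inner ℂ G F = 0)
    {k : ℕ} (φ : Fin k → H) {B : Set (Fin k → ℂ)} (hB : MeasurableSet B) :
    ∫ ω in (fun ω i => Z (φ i) ω) ⁻¹' B, G ω ∂P = 0 := by
  set Y : Ω → Fin k → ℂ := fun ω i => Z (φ i) ω with hY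
  have mY : Measurable Y := measurable_pi_lambda _ fun i => hZ.measurable (φ i)
  have hmp : MeasurePreserving Y P (P.map Y) := mY.measurePreserving P
  have : IsProbabilityMeasure (P.map Y) := Measure.isProbabilityMeasure_map mY.aemeasurable
  have hzero : ∀ g : Lp ℂ 2 (P.map Y), inner ℂ G (Lp.compMeasurePreserving Y hmp g) = 0 := by
    have hc : Continuous fun g : Lp ℂ 2 (P.map Y) =>
        inner ℂ G (Lp.compMeasurePreserving Y hmp g) :=
      continuous_const.inner (Lp.isometry_compMeasurePreserving hmp).continuous
    refine fun g => DenseRange.induction_on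
      (p := fun g => inner ℂ G (Lp.compMeasurePreserving Y hmp g) = 0)
      (SchwartzMap.denseRange_toLpCLM (E := Fin k → ℂ) (F := ℂ) (p := 2) (by simp)
        (μ := P.map Y)) g (isClosed_eq hc continuous_const) ?_
    intro f
    refine hG k f φ _ f.hasTemperateGrowth ?_
    have h1 := Lp.coeFn_compMeasurePreserving (SchwartzMap.toLpCLM ℝ ℂ 2 (P.map Y) f) hmp
    have h2 := hmp.quasiMeasurePreserving.ae_eq_comp (f.coeFn_toLp 2 (P.map Y))
    filter_upwards [h1, h2] with ω h3 h4
    exact h3.trans h4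
  have h1 := hzero (indicatorConstLp 2 hB (by simp) 1)
  rw [Lp.indicatorConstLp_compMeasurePreserving, ← inner_conj_symm,
    L2.inner_indicatorConstLp_one, map_eq_zero] at h1
  exact h1

/-- A square integrable random variable orthogonal to all smooth random variables vanishes. -/
theorem IsComplexIsonormal.eq_zero_of_inner_smooth [IsProbabilityMeasure P]
    (hZ : IsComplexIsonormal Z P) (hgen : SigmaAlgebraGeneratedBy Z P) (G : Lp ℂ 2 P)
    (hG : ∀ (k : ℕ) (f : (Fin k → ℂ) → ℂ) (φ : Fin k → H) (F : Lp ℂ 2 P),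
      Function.HasTemperateGrowth f → (∀ᵐ ω ∂P, F ω = f fun i => Z (φ i) ω) → inner ℂ G F = 0) :
    G = 0 := by
  have hint : Integrable G P := (Lp.memLp G).integrable (by norm_num)
  have hcomap : ∀ h, MeasurableSpace.comap (Z h) inferInstance ≤ ‹MeasurableSpace Ω› := fun h =>
    (hZ.measurable h).comap_le
  have hle : (⨆ h, MeasurableSpace.comap (Z h) inferInstance) ≤ ‹MeasurableSpace Ω› :=
    iSup_le hcomap
  have hcyl := fun {k : ℕ} (φ : Fin k → H) {B : Set (Fin k → ℂ)} (hB : MeasurableSet B) =>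
    hZ.setIntegral_preimage_eq_zero G hG φ hB
  have huniv : ∫ ω, G ω ∂P = 0 := by
    have := hcyl (k := 0) Fin.elim0 MeasurableSet.univ
    simpa using this
  -- A π-λ argument: the cylinders form a π-system generating `σ(Z)`, and the sets over which `G`
  -- integrates to `0` form a λ-system because the total integral is `0`.
  have hsub : ∀ t, MeasurableSet[⨆ h, MeasurableSpace.comap (Z h) inferInstance] t →
      ∫ ω in t, G ω ∂P = 0 := by
    have hgen' : (⨆ h, MeasurableSpace.comap (Z h) (inferInstance : MeasurableSpace ℂ)) =
        MeasurableSpace.generateFrom (piiUnionInter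
          (fun h => {s | MeasurableSet[MeasurableSpace.comap (Z h) inferInstance] s}) Set.univ) := by
      have h1 := generateFrom_piiUnionInter_measurableSet
        (fun h => MeasurableSpace.comap (Z h) (inferInstance : MeasurableSpace ℂ)) Set.univ
      rw [iSup_univ] at h1
      exact h1.symm
    refine MeasurableSpace.induction_on_inter
      (C := fun t _ => ∫ ω in t, G ω ∂P = 0) hgen'
      (isPiSystem_piiUnionInter _
        (fun h => @MeasurableSpace.isPiSystem_measurableSet _ (MeasurableSpace.comap (Z h) _)) _)
      (by simp) ?_ ?_ ?_
    -- A finite intersection of events `Z h ∈ B h` is the preimage of a product set under the vector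
    -- of these `Z h`.
    · rintro _ ⟨t, -, f, hf, rfl⟩
      choose! B hB using hf
      let e := t.equivFin
      have h1 := hcyl (fun i => ((e.symm i : t) : H))
        (B := Set.univ.pi fun i => B (e.symm i : t))
        (MeasurableSet.univ_pi fun i => (hB _ (e.symm i).2).1)
      convert h1 using 3
      ext ω
      simp only [Set.mem_iInter, Set.mem_preimage, Set.mem_pi, Set.mem_univ, true_implies]
      constructor
      · intro h i
        have := h _ (e.symm i).2
        rw [← (hB _ (e.symm i).2).2] at this
        exact this
      · intro h x hx
        rw [← (hB x hx).2]
        have := h (e ⟨x, hx⟩)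
        rwa [Equiv.symm_apply_apply] at this
    · intro t ht h
      have h1 := integral_add_compl (hle t ht) hint
      rw [h, huniv, zero_add] at h1
      exact h1
    · intro f hd hf h
      rw [integral_iUnion (fun i => hle _ (hf i)) hd hint.integrableOn]
      simp [h]
  rw [Lp.eq_zero_iff_ae_eq_zero]
  exact hint.ae_eq_zero_of_forall_setIntegral_eq_zero fun s hs _ => by
    obtain ⟨t, ht, hst⟩ := hgen s hs
    rw [setIntegral_congr_set hst, hsub t ht]

end Density

/-! ### The Malliavin derivative and its adjoint -/

section Malliavin

variable {H : Type u} [NormedAddCommGroup H] [InnerProductSpace ℂ H]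
  {Ω : Type v} [MeasurableSpace Ω] {P : Measure Ω} {Z : H → Ω → ℂ}

/-- The graph of `D` on smooth random variables. -/
noncomputable def smoothGraph (Z : H → Ω → ℂ) (P : Measure Ω) : Submodule ℂ (Lp ℂ 2 P × Lp H 2 P) :=
  Submodule.span ℂ {q : Lp ℂ 2 P × Lp H 2 P |
    ∃ (k : ℕ) (f : (Fin k → ℂ) → ℂ) (φ : Fin k → H), Function.HasTemperateGrowth f ∧
      (∀ᵐ ω ∂P, q.1 ω = f fun i => Z (φ i) ω) ∧
      (∀ᵐ ω ∂P, q.2 ω = ∑ j, wirtinger f j (fun i => Z (φ i) ω) • φ j)}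

lemma wirtinger_eq_wirtingerDir {k : ℕ} (f : (Fin k → ℂ) → ℂ) (j : Fin k) :
    wirtinger f j = wirtingerDir f (Pi.single j 1) := by
  ext y
  simp [wirtinger, wirtingerDir, ← Pi.single_smul]

namespace IsComplexIsonormal

lemma memLp_smul (hZ : IsComplexIsonormal Z P) {k : ℕ} (φ : Fin k → H) {f : (Fin k → ℂ) → ℂ}
    (hf : f.HasTemperateGrowth) (h : H) : MemLp (fun ω => (f fun i => Z (φ i) ω) • h) 2 P :=
  (ContinuousLinearMap.toSpanSingleton ℂ h).comp_memLp' (hZ.memLp_comp φ hf (by simp))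

lemma exists_mem_smoothGraph (hZ : IsComplexIsonormal Z P) {k : ℕ} {f : (Fin k → ℂ) → ℂ}
    (hf : f.HasTemperateGrowth) (φ : Fin k → H) :
    ∃ q ∈ smoothGraph Z P, (∀ᵐ ω ∂P, q.1 ω = f fun i => Z (φ i) ω) ∧
      (∀ᵐ ω ∂P, q.2 ω = ∑ j, wirtinger f j (fun i => Z (φ i) ω) • φ j) := by
  have hw : ∀ j, Function.HasTemperateGrowth (wirtinger f j) := fun j =>
    wirtinger_eq_wirtingerDir f j ▸ hf.wirtingerDir (Pi.single j 1)
  have h1 := hZ.memLp_comp φ hf (p := 2) (by simp)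
  have h2 : MemLp (fun ω => ∑ j, wirtinger f j (fun i => Z (φ i) ω) • φ j) 2 P :=
    memLp_finsetSum _ fun j _ => hZ.memLp_smul φ (hw j) (φ j)
  exact ⟨(h1.toLp _, h2.toLp _), Submodule.subset_span
    ⟨k, f, φ, hf, h1.coeFn_toLp, h2.coeFn_toLp⟩, h1.coeFn_toLp, h2.coeFn_toLp⟩

/-- Integration by parts: `u(Z ψ) h` is in the domain of the divergence, with divergence
`u(Z ψ) Z(h) - conj (∂ (conj u) (Z ψ) h)`. -/
theorem inner_smoothGraph (hZ : IsComplexIsonormal Z P) {l : ℕ} {u : (Fin l → ℂ) → ℂ}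
    (hu : u.HasTemperateGrowth) (ψ : Fin l → H) (h : H) {U : Lp H 2 P}
    (hU : ∀ᵐ ω ∂P, U ω = (u fun i => Z (ψ i) ω) • h) {d : Lp ℂ 2 P}
    (hd : ∀ᵐ ω ∂P, d ω = (u fun i => Z (ψ i) ω) * Z h ω -
      conj (wirtingerDir (fun z => conj (u z)) (fun i => inner ℂ h (ψ i)) fun i => Z (ψ i) ω))
    {q : Lp ℂ 2 P × Lp H 2 P} (hq : q ∈ smoothGraph Z P) :
    inner ℂ d q.1 = inner ℂ U q.2 := by
  induction hq using Submodule.span_induction with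
  | zero => simp
  | add x y _ _ hx hy => simp only [Prod.fst_add, Prod.snd_add, inner_add_right, hx, hy]
  | smul c x _ hx => simp only [Prod.smul_fst, Prod.smul_snd, inner_smul_right, hx]
  | mem q hq =>
    obtain ⟨k, f, φ, hf, h1, h2⟩ := hq
    -- Concatenating `φ` and `ψ` makes `f * conj u` one function of a single Gaussian vector;
    -- integration by parts and the product rule then split the two derivatives.
    set Φ : Fin k ⊕ Fin l → H := Sum.elim φ ψ with hΦ
    have hf' := hf.comp_right (ι := Fin k ⊕ Fin l) Sum.inl
    have hu' := hu.conj.comp_right (ι := Fin k ⊕ Fin l) Sum.inr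
    have key := hZ.integral_conj_mul_comp Φ h (hf'.mul hu')
    set a : Fin k ⊕ Fin l → ℂ := fun i => inner ℂ h (Φ i) with ha
    have hW : ∀ y : Fin k ⊕ Fin l → ℂ,
        wirtingerDir ((fun z => f (z ∘ Sum.inl)) * fun z => conj (u (z ∘ Sum.inr))) a y =
        wirtingerDir f (fun i => inner ℂ h (φ i)) (y ∘ Sum.inl) * conj (u (y ∘ Sum.inr)) +
        f (y ∘ Sum.inl) *
          wirtingerDir (fun z => conj (u z)) (fun i => inner ℂ h (ψ i)) (y ∘ Sum.inr) := by
      intro y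
      have h3 := wirtingerDir_mul (hf'.differentiable y) (hu'.differentiable y) a
      rw [wirtingerDir_comp Sum.inl a y (hf.differentiable _),
        wirtingerDir_comp (f := fun z => conj (u z)) Sum.inr a y (hu.conj.differentiable _)] at h3
      exact h3
    simp only [hW] at key
    have i1 : Integrable (fun ω => wirtingerDir f (fun i => inner ℂ h (φ i)) (fun i => Z (φ i) ω) *
        conj (u fun i => Z (ψ i) ω)) P :=
      MemLp.integrable_mul (p := 2) (q := 2) (hZ.memLp_comp φ (hf.wirtingerDir _) (by simp))
        (hZ.memLp_comp ψ hu.conj (by simp))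
    have i2 : Integrable (fun ω => f (fun i => Z (φ i) ω) *
        wirtingerDir (fun z => conj (u z)) (fun i => inner ℂ h (ψ i)) (fun i => Z (ψ i) ω)) P :=
      MemLp.integrable_mul (p := 2) (q := 2) (hZ.memLp_comp φ hf (by simp))
        (hZ.memLp_comp ψ (hu.conj.wirtingerDir _) (by simp))
    have i3 : Integrable (fun ω => conj (Z h ω) * (f (fun i => Z (φ i) ω) *
        conj (u fun i => Z (ψ i) ω))) P :=
      MemLp.integrable_mul (p := 2) (q := 2) (hZ.memLp h (p := 2) (by simp)).star
        (hZ.memLp_comp Φ (hf'.mul hu') (p := 2) (by simp))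
    have key' : ∫ ω, conj (Z h ω) * (f (fun i => Z (φ i) ω) * conj (u fun i => Z (ψ i) ω)) ∂P =
        ∫ ω, (wirtingerDir f (fun i => inner ℂ h (φ i)) (fun i => Z (φ i) ω) *
          conj (u fun i => Z (ψ i) ω) + f (fun i => Z (φ i) ω) *
        wirtingerDir (fun z => conj (u z)) (fun i => inner ℂ h (ψ i)) (fun i => Z (ψ i) ω)) ∂P := key
    rw [integral_add i1 i2] at key'
    have e1 : inner ℂ d q.1 =
        ∫ ω, (conj (Z h ω) * (f (fun i => Z (φ i) ω) * conj (u fun i => Z (ψ i) ω)) -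
          f (fun i => Z (φ i) ω) *
          wirtingerDir (fun z => conj (u z)) (fun i => inner ℂ h (ψ i)) (fun i => Z (ψ i) ω)) ∂P := by
      rw [L2.inner_def]
      refine integral_congr_ae ?_
      filter_upwards [h1, hd] with ω h3 h4
      rw [h3, h4, RCLike.inner_apply, map_sub, map_mul, Complex.conj_conj]
      ring
    have e2 : inner ℂ U q.2 =
        ∫ ω, wirtingerDir f (fun i => inner ℂ h (φ i)) (fun i => Z (φ i) ω) *
          conj (u fun i => Z (ψ i) ω) ∂P := by
      rw [L2.inner_def]
      refine integral_congr_ae ?_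
      filter_upwards [h2, hU] with ω h3 h4
      rw [h3, h4, inner_smul_left, inner_sum, wirtingerDir_eq_sum, mul_comm]
      congr 1
      refine Finset.sum_congr rfl fun j _ => ?_
      rw [inner_smul_right, mul_comm]
    rw [e1, e2, integral_sub i3 i2, key', add_sub_cancel_right]

/-- For fixed `U` and `d` the duality identity is a closed condition on `q`, so it survives on the
closure of the graph, as closability requires. -/
lemma exists_divergence (hZ : IsComplexIsonormal Z P) {l : ℕ} {u : (Fin l → ℂ) → ℂ}
    (hu : u.HasTemperateGrowth) (ψ : Fin l → H) (h : H) :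
    ∃ (U : Lp H 2 P) (d : Lp ℂ 2 P), (∀ᵐ ω ∂P, U ω = (u fun i => Z (ψ i) ω) • h) ∧
      ∀ q ∈ (smoothGraph Z P).topologicalClosure, inner ℂ d q.1 = inner ℂ U q.2 := by
  have h1 := hZ.memLp_smul ψ hu h
  have h2 : MemLp (fun ω => (u fun i => Z (ψ i) ω) * Z h ω -
      conj (wirtingerDir (fun z => conj (u z)) (fun i => inner ℂ h (ψ i)) fun i => Z (ψ i) ω))
      2 P := by
    have h3 := hu.comp_right (ι := Option (Fin l)) some
    have h4 := (hu.conj.wirtingerDir (fun i => inner ℂ h (ψ i))).conj.comp_right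
      (ι := Option (Fin l)) some
    exact hZ.memLp_comp (fun o : Option (Fin l) => o.elim h ψ)
      ((h3.mul (Function.HasTemperateGrowth.eval none)).sub h4) (by simp)
  refine ⟨h1.toLp _, h2.toLp _, h1.coeFn_toLp, ?_⟩
  let A : (Lp ℂ 2 P × Lp H 2 P) →L[ℂ] ℂ :=
    (innerSL ℂ (h2.toLp _)).comp (ContinuousLinearMap.fst ℂ _ _)
  let B : (Lp ℂ 2 P × Lp H 2 P) →L[ℂ] ℂ :=
    (innerSL ℂ (h1.toLp _)).comp (ContinuousLinearMap.snd ℂ _ _)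
  have hle : (smoothGraph Z P).topologicalClosure ≤
      LinearMap.eqLocus (A : (Lp ℂ 2 P × Lp H 2 P) →ₗ[ℂ] ℂ) B :=
    Submodule.topologicalClosure_minimal _
      (fun q hq => hZ.inner_smoothGraph hu ψ h h1.coeFn_toLp h2.coeFn_toLp hq)
      (isClosed_eq A.continuous B.continuous)
  exact fun q hq => hle hq

variable [IsProbabilityMeasure P]

/-- Closability: if `(0, V)` lies in the closed graph, duality gives `⟪u(Z ψ) h, V⟫ = 0` for all
smooth `u`, so each `⟪h, V⟫` is orthogonal to all smooth variables. Separability of `H` makes the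
exceptional null set independent of `h`. -/
lemma eq_zero_of_mem_closure_smoothGraph [TopologicalSpace.SeparableSpace H]
    (hZ : IsComplexIsonormal Z P) (hgen : SigmaAlgebraGeneratedBy Z P)
    (q : Lp ℂ 2 P × Lp H 2 P) (hq : q ∈ (smoothGraph Z P).topologicalClosure) (h0 : q.1 = 0) :
    q.2 = 0 := by
  have : SecondCountableTopology H := UniformSpace.secondCountable_of_separable H
  rw [Lp.eq_zero_iff_ae_eq_zero]
  refine ae_eq_zero_of_forall_inner (𝕜 := ℂ) fun h => ?_
  have hm : MemLp (fun ω => inner ℂ h (q.2 ω)) 2 P := (Lp.memLp q.2).const_inner h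
  have h1 : hm.toLp _ = 0 := by
    refine hZ.eq_zero_of_inner_smooth hgen _ fun l u ψ F hu hF => ?_
    obtain ⟨U, d, hU, hd⟩ := hZ.exists_divergence hu ψ h
    have h2 := hd q hq
    rw [h0, inner_zero_right] at h2
    rw [← inner_conj_symm, map_eq_zero, h2, L2.inner_def, L2.inner_def]
    refine integral_congr_ae ?_
    filter_upwards [hF, hU, hm.coeFn_toLp] with ω h3 h4 h5
    rw [h3, h4, h5, inner_smul_left, RCLike.inner_apply, mul_comm]
  have h2 := hm.coeFn_toLp
  rw [h1] at h2
  exact h2.symm.trans (Lp.coeFn_zero _ _ _)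

lemma dense_domain_smoothD (hZ : IsComplexIsonormal Z P) (hgen : SigmaAlgebraGeneratedBy Z P) :
    Dense ((smoothD Z P).domain : Set (Lp ℂ 2 P)) := by
  rw [Submodule.dense_iff_topologicalClosure_eq_top, Submodule.topologicalClosure_eq_top_iff,
    Submodule.eq_bot_iff]
  intro G hG
  refine hZ.eq_zero_of_inner_smooth hgen G fun k f φ F hf hF => ?_
  obtain ⟨q, hq, h1, -⟩ := hZ.exists_mem_smoothGraph hf φ
  have hFq : q.1 = F := by
    refine Lp.ext ?_
    filter_upwards [h1, hF] with ω h2 h3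
    rw [h2, h3]
  have h2 : F ∈ (smoothD Z P).domain := by
    rw [← hFq]
    exact Submodule.mem_map_of_mem (f := LinearMap.fst ℂ (Lp ℂ 2 P) (Lp H 2 P)) hq
  exact inner_eq_zero_symm.1 (hG F h2)

variable [TopologicalSpace.SeparableSpace H]

/-- `toLinearPMap` has the given submodule as its graph only if the submodule is single-valued: `D
F` must not depend on the representation of `F`. -/
lemma graph_smoothD (hZ : IsComplexIsonormal Z P) (hgen : SigmaAlgebraGeneratedBy Z P) :
    (smoothD Z P).graph = smoothGraph Z P :=
  Submodule.toLinearPMap_graph_eq _ fun q hq h0 =>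
    hZ.eq_zero_of_mem_closure_smoothGraph hgen q (Submodule.le_topologicalClosure _ hq) h0

lemma graph_malliavinD (hZ : IsComplexIsonormal Z P) (hgen : SigmaAlgebraGeneratedBy Z P) :
    (malliavinD Z P).graph = (smoothGraph Z P).topologicalClosure := by
  have hc : (smoothD Z P).IsClosable := by
    refine ⟨(smoothGraph Z P).topologicalClosure.toLinearPMap, ?_⟩
    rw [hZ.graph_smoothD hgen, Submodule.toLinearPMap_graph_eq]
    exact hZ.eq_zero_of_mem_closure_smoothGraph hgen
  rw [malliavinD, ← hc.graph_closure_eq_closure_graph, hZ.graph_smoothD hgen]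

lemma exists_divergence_eq [CompleteSpace H] (hZ : IsComplexIsonormal Z P)
    (hgen : SigmaAlgebraGeneratedBy Z P) {U : Lp H 2 P} {d : Lp ℂ 2 P}
    (h : ∀ q ∈ smoothGraph Z P, inner ℂ d q.1 = inner ℂ U q.2) :
    ∃ hU : U ∈ (divergence Z P).domain, divergence Z P ⟨U, hU⟩ = d := by
  have h1 : ∀ x : (smoothD Z P).domain, inner ℂ d (x : Lp ℂ 2 P) = inner ℂ U (smoothD Z P x) := by
    intro x
    exact h _ (hZ.graph_smoothD hgen ▸ (smoothD Z P).mem_graph x)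
  have hU : U ∈ (divergence Z P).domain := LinearPMap.mem_adjoint_domain_of_exists U ⟨d, h1⟩
  exact ⟨hU, LinearPMap.adjoint_apply_eq (hZ.dense_domain_smoothD hgen) ⟨U, hU⟩ h1⟩

lemma exists_malliavinD_eq (hZ : IsComplexIsonormal Z P) (hgen : SigmaAlgebraGeneratedBy Z P)
    {F : Lp ℂ 2 P} {U : Lp H 2 P} (h : (F, U) ∈ (smoothGraph Z P).topologicalClosure) :
    ∃ hF : F ∈ (malliavinD Z P).domain, malliavinD Z P ⟨F, hF⟩ = U := by
  rw [← hZ.graph_malliavinD hgen, LinearPMap.mem_graph_iff] at h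
  obtain ⟨y, rfl, h2⟩ := h
  exact ⟨y.2, h2⟩

/-- The two hypotheses say `D F = U` and `δ U = d`, so `F` lies in the natural domain of `δ D`. -/
lemma exists_ouL_eq [CompleteSpace H] (hZ : IsComplexIsonormal Z P)
    (hgen : SigmaAlgebraGeneratedBy Z P) {F : Lp ℂ 2 P} {U : Lp H 2 P} {d : Lp ℂ 2 P}
    (h : (F, U) ∈ (smoothGraph Z P).topologicalClosure)
    (h' : ∀ q ∈ smoothGraph Z P, inner ℂ d q.1 = inner ℂ U q.2) :
    ∃ hF : F ∈ (ouL Z P).domain, ouL Z P ⟨F, hF⟩ = d := by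
  obtain ⟨hF, h1⟩ := hZ.exists_malliavinD_eq hgen h
  obtain ⟨hU, h2⟩ := hZ.exists_divergence_eq hgen h'
  have h3 : F ∈ (ouL Z P).domain :=
    ⟨⟨⟨F, hF⟩, (by
      change malliavinD Z P ⟨F, hF⟩ ∈ (divergence Z P).domain
      rw [h1]; exact hU), rfl⟩, hF⟩
  refine ⟨h3, ?_⟩
  subst h1
  exact h2

end IsComplexIsonormal

end Malliavin

/-! ### The conjugate process -/

section Conj

variable {H : Type u} [NormedAddCommGroup H] [InnerProductSpace ℂ H]
  {Ω : Type v} {Z : H → Ω → ℂ}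

/-- An antilinear isometry reverses the inner product. -/
lemma inner_antiunitary (cj : H ≃ₗᵢ⋆[ℂ] H) (x y : H) :
    inner ℂ (cj x) (cj y) = inner ℂ y x := by
  -- The four norms of the polarization formula for `⟪cj x, cj y⟫` are those of the formula for `⟪y,
  -- x⟫`.
  have e1 : ‖cj x + cj y‖ = ‖y + x‖ := by rw [← map_add, cj.norm_map, add_comm]
  have e2 : ‖cj x - cj y‖ = ‖y - x‖ := by rw [← map_sub, cj.norm_map, norm_sub_rev]
  have e3 : ‖cj x - (RCLike.I : ℂ) • cj y‖ = ‖y - (RCLike.I : ℂ) • x‖ := by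
    have h1 : cj x - (RCLike.I : ℂ) • cj y = cj (x + Complex.I • y) := by
      rw [map_add, map_smulₛₗ, Complex.conj_I, neg_smul, sub_eq_add_neg]
      rfl
    have h2 : y - (RCLike.I : ℂ) • x = (-Complex.I) • (x + Complex.I • y) := by
      rw [smul_add, smul_smul, neg_mul, Complex.I_mul_I, neg_neg, one_smul, neg_smul,
        sub_eq_add_neg, add_comm]
      rfl
    rw [h1, h2, cj.norm_map, norm_smul]
    simp
  have e4 : ‖cj x + (RCLike.I : ℂ) • cj y‖ = ‖y + (RCLike.I : ℂ) • x‖ := by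
    have h1 : cj x + (RCLike.I : ℂ) • cj y = cj (x - Complex.I • y) := by
      rw [map_sub, map_smulₛₗ, Complex.conj_I, neg_smul, sub_neg_eq_add]
      rfl
    have h2 : y + (RCLike.I : ℂ) • x = Complex.I • (x - Complex.I • y) := by
      rw [smul_sub, smul_smul, Complex.I_mul_I, neg_smul, one_smul, sub_neg_eq_add, add_comm]
      rfl
    rw [h1, h2, cj.norm_map, norm_smul]
    simp
  rw [inner_eq_sum_norm_sq_div_four, inner_eq_sum_norm_sq_div_four y x, e1, e2, e3, e4]

/-- The conjugate process `h ↦ conj (Z (cj h))`. -/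
noncomputable def conjProcess (cj : H ≃ₗᵢ⋆[ℂ] H) (Z : H → Ω → ℂ) (h : H) (ω : Ω) : ℂ :=
  conj (Z (cj h) ω)

lemma conjProcess_apply_cj {cj : H ≃ₗᵢ⋆[ℂ] H} (hcj : ∀ h, cj (cj h) = h) (h : H) (ω : Ω) :
    conjProcess cj Z (cj h) ω = conj (Z h ω) := by
  rw [conjProcess, hcj]

variable [MeasurableSpace Ω] {P : Measure Ω}

/-- Conjugating the values and applying `cj` to the index each reverse the inner product, so the
covariance is unchanged. -/
lemma IsComplexIsonormal.conjProcess (cj : H ≃ₗᵢ⋆[ℂ] H) (hZ : IsComplexIsonormal Z P) :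
    IsComplexIsonormal (conjProcess cj Z) P where
  measurable h := Complex.continuous_conj.measurable.comp (hZ.measurable (cj h))
  gaussian := (hZ.gaussian.comp_right cj).comp_left
    fun _ => Complex.conjCLE.toContinuousLinearMap
  mean_zero h := by
    simp only [_root_.conjProcess]
    rw [integral_conj, hZ.mean_zero, map_zero]
  covariance g h := by
    simp only [_root_.conjProcess, Complex.conj_conj]
    rw [← inner_antiunitary cj, ← hZ.covariance]
    simp only [mul_comm]
  relation g h := by
    simp only [_root_.conjProcess, ← map_mul]
    rw [integral_conj, hZ.relation, map_zero]

variable {cj : H ≃ₗᵢ⋆[ℂ] H}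

lemma SigmaAlgebraGeneratedBy.conjProcess (hcj : ∀ h, cj (cj h) = h)
    (hgen : SigmaAlgebraGeneratedBy Z P) : SigmaAlgebraGeneratedBy (conjProcess cj Z) P := by
  intro s hs
  obtain ⟨t, ht, hst⟩ := hgen s hs
  refine ⟨t, ?_, hst⟩
  have hle : (⨆ h, MeasurableSpace.comap (Z h) (inferInstance : MeasurableSpace ℂ)) ≤
      ⨆ h, MeasurableSpace.comap (_root_.conjProcess cj Z h) inferInstance := by
    refine iSup_le fun h => le_trans ?_ (le_iSup _ (cj h))
    have h1 : Z h = (fun z => conj z) ∘ _root_.conjProcess cj Z (cj h) := by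
      ext ω
      simp [conjProcess_apply_cj hcj]
    rw [h1, ← MeasurableSpace.comap_comp]
    exact MeasurableSpace.comap_mono Complex.continuous_conj.measurable.comap_le
  exact hle t ht

section WirtingerConj

variable {k : ℕ} {f : (Fin k → ℂ) → ℂ}

/-- Coordinatewise complex conjugation as a real continuous linear map. -/
noncomputable def piConj (k : ℕ) : (Fin k → ℂ) →L[ℝ] (Fin k → ℂ) :=
  ContinuousLinearMap.pi fun j => Complex.conjCLE.toContinuousLinearMap ∘L
    ContinuousLinearMap.proj (R := ℝ) (φ := fun _ : Fin k => ℂ) j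

lemma piConj_single (j : Fin k) (c : ℂ) : piConj k (Pi.single j c) = Pi.single j (conj c) := by
  ext i
  by_cases h : i = j
  · subst h; simp [piConj]
  · simp [piConj, h]

lemma fderiv_comp_piConj (hf : Differentiable ℝ f) (z v : Fin k → ℂ) :
    fderiv ℝ (fun z => f (piConj k z)) z v = fderiv ℝ f (piConj k z) (piConj k v) := by
  have h := (hf (piConj k z)).hasFDerivAt.comp z (piConj k).hasFDerivAt
  have h2 : HasFDerivAt (fun z => f (piConj k z)) (fderiv ℝ f (piConj k z) ∘L piConj k) z := h
  rw [h2.fderiv]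
  rfl

lemma wirtinger_comp_piConj (hf : Differentiable ℝ f) (j : Fin k) (z : Fin k → ℂ) :
    wirtinger (fun z => f (piConj k z)) j z = wirtingerBar f j (piConj k z) := by
  rw [wirtinger, wirtingerBar, fderiv_comp_piConj hf, fderiv_comp_piConj hf, piConj_single,
    piConj_single, map_one, Complex.conj_I, Pi.single_neg, map_neg]
  ring

lemma wirtingerBar_comp_piConj (hf : Differentiable ℝ f) (j : Fin k) (z : Fin k → ℂ) :
    wirtingerBar (fun z => f (piConj k z)) j z = wirtinger f j (piConj k z) := by
  rw [wirtinger, wirtingerBar, fderiv_comp_piConj hf, fderiv_comp_piConj hf, piConj_single,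
    piConj_single, map_one, Complex.conj_I, Pi.single_neg, map_neg]
  ring

end WirtingerConj

/-- Replacing `f` by `f ∘ conj` and `φ` by `cj φ` leaves the random variable unchanged and exchanges
`∂` with `∂̄`. Thus all results on `D` hold for `D̄`. -/
lemma smoothDBar_eq (hcj : ∀ h, cj (cj h) = h) :
    smoothDBar Z P cj = smoothD (conjProcess cj Z) P := by
  rw [smoothDBar, smoothD]
  congr 2
  ext q
  constructor
  · rintro ⟨k, f, φ, hf, h1, h2⟩
    have e : ∀ ω, piConj k (fun i => conjProcess cj Z (cj (φ i)) ω) = fun i => Z (φ i) ω := by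
      intro ω
      ext i
      simp [piConj, conjProcess_apply_cj hcj]
    refine ⟨k, fun z => f (piConj k z), fun i => cj (φ i),
      hf.comp (piConj k).hasTemperateGrowth, ?_, ?_⟩
    · filter_upwards [h1] with ω h
      rw [h, e]
    · filter_upwards [h2] with ω h
      simp only [h, wirtinger_comp_piConj hf.differentiable, e]
  · rintro ⟨k, f, φ, hf, h1, h2⟩
    have e : ∀ ω, piConj k (fun i => Z (cj (φ i)) ω) = fun i => conjProcess cj Z (φ i) ω := by
      intro ω
      ext i
      simp [piConj, conjProcess]
    refine ⟨k, fun z => f (piConj k z), fun i => cj (φ i),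
      hf.comp (piConj k).hasTemperateGrowth, ?_, ?_⟩
    · filter_upwards [h1] with ω h
      rw [h, e]
    · filter_upwards [h2] with ω h
      simp only [h, wirtingerBar_comp_piConj hf.differentiable, e, hcj]

lemma malliavinDBar_eq (hcj : ∀ h, cj (cj h) = h) :
    malliavinDBar Z P cj = malliavinD (conjProcess cj Z) P := by
  rw [malliavinDBar, malliavinD, smoothDBar_eq hcj]

lemma ouLBar_eq [CompleteSpace H] (hcj : ∀ h, cj (cj h) = h) :
    ouLBar Z P cj = ouL (conjProcess cj Z) P := by
  rw [ouLBar, ouL, divergenceBar, divergence, smoothDBar_eq hcj, malliavinDBar_eq hcj]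

end Conj

/-! ### Hermite random variables -/

section HermiteVec

variable {H : Type u} [NormedAddCommGroup H] [InnerProductSpace ℂ H]
  {Ω : Type v} [MeasurableSpace Ω] {P : Measure Ω} {Z : H → Ω → ℂ}

lemma IsComplexIsonormal.memLp_hermite (hZ : IsComplexIsonormal Z P) (m n : ℕ) (h : H) :
    MemLp (fun ω => complexHermite m n (Z h ω) (‖h‖ ^ 2)) 2 P :=
  hZ.memLp_comp (fun _ : Fin 1 => h) (hasTemperateGrowth_complexHermite m n (‖h‖ ^ 2) 0)
    (by simp)

lemma IsComplexIsonormal.memLp_hermite_smul (hZ : IsComplexIsonormal Z P) (m n : ℕ) (h : H) :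
    MemLp (fun ω => complexHermite m n (Z h ω) (‖h‖ ^ 2) • h) 2 P :=
  hZ.memLp_smul (fun _ : Fin 1 => h) (hasTemperateGrowth_complexHermite m n (‖h‖ ^ 2) 0) h

/-- The random variable `J_{m,n}(Z(h), ‖h‖²)`. -/
noncomputable def hermiteVec (hZ : IsComplexIsonormal Z P) (m n : ℕ) (h : H) : Lp ℂ 2 P :=
  (hZ.memLp_hermite m n h).toLp _

/-- The `H`-valued random variable `J_{m,n}(Z(h), ‖h‖²) h`. -/
noncomputable def hermiteGrad (hZ : IsComplexIsonormal Z P) (m n : ℕ) (h : H) : Lp H 2 P :=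
  (hZ.memLp_hermite_smul m n h).toLp _

variable (hZ : IsComplexIsonormal Z P)

lemma coeFn_hermiteVec (m n : ℕ) (h : H) :
    ∀ᵐ ω ∂P, hermiteVec hZ m n h ω = complexHermite m n (Z h ω) (‖h‖ ^ 2) :=
  (hZ.memLp_hermite m n h).coeFn_toLp

lemma coeFn_hermiteGrad (m n : ℕ) (h : H) :
    ∀ᵐ ω ∂P, hermiteGrad hZ m n h ω = complexHermite m n (Z h ω) (‖h‖ ^ 2) • h :=
  (hZ.memLp_hermite_smul m n h).coeFn_toLp

lemma hermiteVec_zero_mem_smoothGraph (n : ℕ) (h : H) :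
    (hermiteVec hZ 0 n h, 0) ∈ smoothGraph Z P := by
  obtain ⟨q, hq, h1, h2⟩ := hZ.exists_mem_smoothGraph
    (hasTemperateGrowth_complexHermite 0 n (‖h‖ ^ 2) (0 : Fin 1)) fun _ => h
  have e1 : q.1 = hermiteVec hZ 0 n h := by
    refine Lp.ext ?_
    filter_upwards [h1, coeFn_hermiteVec hZ 0 n h] with ω h3 h4
    rw [h3, h4]
  have e2 : q.2 = 0 := by
    refine Lp.ext ?_
    filter_upwards [h2, Lp.coeFn_zero H 2 P] with ω h3 h4
    rw [h3, h4]
    simp [wirtinger_eq_wirtingerDir, wirtingerDir_complexHermite_zero]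
  rw [← e1, ← e2]
  exact hq

lemma hermiteVec_succ_mem_smoothGraph (m n : ℕ) (h : H) :
    (hermiteVec hZ (m + 1) n h, ((m + 1 : ℕ) : ℂ) • hermiteGrad hZ m n h) ∈ smoothGraph Z P := by
  obtain ⟨q, hq, h1, h2⟩ := hZ.exists_mem_smoothGraph
    (hasTemperateGrowth_complexHermite (m + 1) n (‖h‖ ^ 2) (0 : Fin 1)) fun _ => h
  have e1 : q.1 = hermiteVec hZ (m + 1) n h := by
    refine Lp.ext ?_
    filter_upwards [h1, coeFn_hermiteVec hZ (m + 1) n h] with ω h3 h4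
    rw [h3, h4]
  have e2 : q.2 = ((m + 1 : ℕ) : ℂ) • hermiteGrad hZ m n h := by
    refine Lp.ext ?_
    filter_upwards [h2, coeFn_hermiteGrad hZ m n h,
      Lp.coeFn_smul ((m + 1 : ℕ) : ℂ) (hermiteGrad hZ m n h)] with ω h3 h4 h5
    rw [h3, h5, Pi.smul_apply, h4]
    simp only [wirtinger_eq_wirtingerDir, wirtingerDir_complexHermite_succ, smul_smul]
    simp
  rw [← e1, ← e2]
  exact hq

/-- `J_{m+1,n}(Z(h))` is the divergence of `J_{m,n}(Z(h)) h`. -/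
lemma inner_hermiteVec_succ (m n : ℕ) (h : H) {q : Lp ℂ 2 P × Lp H 2 P}
    (hq : q ∈ smoothGraph Z P) :
    inner ℂ (hermiteVec hZ (m + 1) n h) q.1 = inner ℂ (hermiteGrad hZ m n h) q.2 := by
  refine hZ.inner_smoothGraph (hasTemperateGrowth_complexHermite m n (‖h‖ ^ 2) (0 : Fin 1))
    (fun _ => h) h (coeFn_hermiteGrad hZ m n h) ?_ hq
  filter_upwards [coeFn_hermiteVec hZ (m + 1) n h] with ω h1
  rw [h1]
  simp only [conj_complexHermite]
  cases n with
  | zero =>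
    rw [complexHermite_succ_zero, wirtingerDir_complexHermite_zero, map_zero, sub_zero, mul_comm]
  | succ n =>
    rw [complexHermite_succ_succ, wirtingerDir_complexHermite_succ, inner_self_eq_norm_sq_to_K]
    simp only [map_mul, map_natCast, conj_complexHermite]
    push_cast
    simp
    ring

lemma inner_hermiteGrad (m n : ℕ) (g h : H) :
    inner ℂ (hermiteGrad hZ m n g) (hermiteGrad hZ m n h) =
      inner ℂ g h * inner ℂ (hermiteVec hZ m n g) (hermiteVec hZ m n h) := by
  rw [L2.inner_def, L2.inner_def, ← integral_const_mul]
  refine integral_congr_ae ?_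
  filter_upwards [coeFn_hermiteVec hZ m n g, coeFn_hermiteVec hZ m n h,
    coeFn_hermiteGrad hZ m n g, coeFn_hermiteGrad hZ m n h] with ω h1 h2 h3 h4
  rw [h1, h2, h3, h4, inner_smul_left, inner_smul_right, RCLike.inner_apply]
  ring

/-- Each step moves the divergence in the left argument onto the right one, whose derivative
supplies the factor `m + 1` and one more `⟪g, h⟫`. -/
lemma inner_hermiteVec_left (m n : ℕ) (g h : H) :
    inner ℂ (hermiteVec hZ m n g) (hermiteVec hZ m n h) =
      (m.factorial : ℂ) * inner ℂ g h ^ m *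
        inner ℂ (hermiteVec hZ 0 n g) (hermiteVec hZ 0 n h) := by
  induction m with
  | zero => simp
  | succ m ih =>
    rw [inner_hermiteVec_succ hZ m n g (hermiteVec_succ_mem_smoothGraph hZ m n h),
      inner_smul_right, inner_hermiteGrad, ih, Nat.factorial_succ]
    push_cast
    ring

variable {cj : H ≃ₗᵢ⋆[ℂ] H}

lemma hermiteVec_conjProcess (hcj : ∀ h, cj (cj h) = h) (m n : ℕ) (h : H) :
    hermiteVec (hZ.conjProcess cj) n m (cj h) = hermiteVec hZ m n h := by
  refine Lp.ext ?_
  filter_upwards [coeFn_hermiteVec hZ m n h,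
    coeFn_hermiteVec (hZ.conjProcess cj) n m (cj h)] with ω h1 h2
  rw [h1, h2, conjProcess_apply_cj hcj, complexHermite_conj, cj.norm_map]

theorem inner_hermiteVec [IsProbabilityMeasure P] (hcj : ∀ h, cj (cj h) = h) (m n : ℕ) (g h : H) :
    inner ℂ (hermiteVec hZ m n g) (hermiteVec hZ m n h) =
      (m.factorial * n.factorial : ℂ) * inner ℂ (diagTensor cj m n g) (diagTensor cj m n h) := by
  have h0 : inner ℂ (hermiteVec (hZ.conjProcess cj) 0 0 (cj g))
      (hermiteVec (hZ.conjProcess cj) 0 0 (cj h)) = 1 := by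
    rw [L2.inner_def]
    have : ∀ᵐ ω ∂P, inner ℂ (hermiteVec (hZ.conjProcess cj) 0 0 (cj g) ω)
        (hermiteVec (hZ.conjProcess cj) 0 0 (cj h) ω) = 1 := by
      filter_upwards [coeFn_hermiteVec (hZ.conjProcess cj) 0 0 (cj g),
        coeFn_hermiteVec (hZ.conjProcess cj) 0 0 (cj h)] with ω h1 h2
      rw [h1, h2, complexHermite_zero_zero, complexHermite_zero_zero]
      simp
    rw [integral_congr_ae this]
    simp
  -- Once `m` is lowered to `0`, the conjugate process turns bidegree `(0, n)` into `(n, 0)` and the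
  -- same lemma lowers `n`; the remaining `J_{0,0} = 1` has norm `1`.
  rw [inner_hermiteVec_left, ← hermiteVec_conjProcess hZ hcj 0 n g,
    ← hermiteVec_conjProcess hZ hcj 0 n h, inner_hermiteVec_left, h0, inner_diagTensor]
  ring

end HermiteVec

/-! ### Complex Wiener–Itô integrals -/

section WienerIto

variable {H : Type u} [NormedAddCommGroup H] [InnerProductSpace ℂ H]
  {Ω : Type v} [MeasurableSpace Ω] {P : Measure Ω} {Z : H → Ω → ℂ} {cj : H ≃ₗᵢ⋆[ℂ] H}

lemma isWienerIto_iff (hZ : IsComplexIsonormal Z P) (m n : ℕ)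
    (T : KernelSp H m n →L[ℂ] Lp ℂ 2 P) :
    IsWienerIto cj Z P m n T ↔ ∀ h, T (diagTensor cj m n h) = hermiteVec hZ m n h := by
  refine forall_congr' fun h => ⟨fun e => Lp.ext ?_, fun e => ?_⟩
  · filter_upwards [e, coeFn_hermiteVec hZ m n h] with ω h1 h2
    rw [h2, ← h1, diagTensor]
  · filter_upwards [coeFn_hermiteVec hZ m n h] with ω h2
    rw [← h2, ← e, diagTensor]

/-- Existence is the proportionality of Gram matrices with constant `m! n!`; uniqueness is totality
of the diagonal tensors. -/
theorem existsUnique_isWienerIto [IsProbabilityMeasure P] (hZ : IsComplexIsonormal Z P)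
    (hcj : ∀ h, cj (cj h) = h) (m n : ℕ) : ∃! T, IsWienerIto cj Z P m n T := by
  have htot := isTotal_diagTensor cj m n
  obtain ⟨T, hT⟩ := htot.exists_clm (hermiteVec hZ m n)
    (c := (m.factorial * n.factorial : ℝ)) (by positivity) fun g h => by
      rw [inner_hermiteVec hZ hcj]
      push_cast
      rfl
  refine ⟨T, (isWienerIto_iff hZ m n T).2 hT, fun S hS => htot.clm_ext fun h => ?_⟩
  rw [(isWienerIto_iff hZ m n S).1 hS, hT]

lemma wienerIto_diagTensor [IsProbabilityMeasure P] (hZ : IsComplexIsonormal Z P)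
    (hcj : ∀ h, cj (cj h) = h) (m n : ℕ) (h : H) :
    wienerIto cj Z P m n (diagTensor cj m n h) = hermiteVec hZ m n h := by
  have hex := (existsUnique_isWienerIto (P := P) hZ hcj m n).exists
  refine (isWienerIto_iff hZ m n _).1 ?_ h
  rw [wienerIto, dif_pos hex]
  exact hex.choose_spec

end WienerIto

/-! ### Malliavin calculus of operators with values in a chaos -/

section Chaos

variable {H : Type u} [NormedAddCommGroup H] [InnerProductSpace ℂ H]
  {Ω : Type v} [MeasurableSpace Ω] {P : Measure Ω} {Z : H → Ω → ℂ}
  {ι K : Type*} [NormedAddCommGroup K] [InnerProductSpace ℂ K] [CompleteSpace K]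
  {v : ι → K} {e : ι → H}

/-- A bounded operator with graph in the Malliavin derivative on a total family has
graph in the closure everywhere. -/
lemma IsTotalFamily.mem_closure_smoothGraph (hv : IsTotalFamily v) (T : K →L[ℂ] Lp ℂ 2 P)
    (U : K →L[ℂ] Lp H 2 P) (h : ∀ i, (T (v i), U (v i)) ∈ smoothGraph Z P) (f : K) :
    (T f, U f) ∈ (smoothGraph Z P).topologicalClosure :=
  hv.mem_of_isClosed
    (S := (smoothGraph Z P).topologicalClosure.comap (T.prod U).toLinearMap)
    ((smoothGraph Z P).isClosed_topologicalClosure.preimage (T.prod U).continuous)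
    (fun i => Submodule.le_topologicalClosure _ (h i)) f

lemma IsTotalFamily.inner_eq_inner (hv : IsTotalFamily v) (T : K →L[ℂ] Lp ℂ 2 P)
    (U : K →L[ℂ] Lp H 2 P) {q : Lp ℂ 2 P × Lp H 2 P}
    (h : ∀ i, inner ℂ (T (v i)) q.1 = inner ℂ (U (v i)) q.2) (f : K) :
    inner ℂ (T f) q.1 = inner ℂ (U f) q.2 := by
  -- The inner product is antilinear on the left; conjugating gives bounded linear functionals of
  -- `f`, determined on `v`.
  have e : (innerSL ℂ q.1) ∘L T = (innerSL ℂ q.2) ∘L U := hv.clm_ext fun i => by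
    simpa using congrArg conj (h i)
  simpa using congrArg conj (congrArg (fun A : K →L[ℂ] ℂ => A f) e)

/-- The gradient operator of a chaos-valued operator. -/
lemma IsTotalFamily.exists_gradient [CompleteSpace H] (hv : IsTotalFamily v)
    (hZ : IsComplexIsonormal Z P) {m n : ℕ} {T : K →L[ℂ] Lp ℂ 2 P} (hT : ∀ i, T (v i) = hermiteVec hZ (m + 1) n (e i))
    {c : ℝ} (hc : 0 ≤ c) (hgram : ∀ i j, inner ℂ (hermiteGrad hZ m n (e i))
      (hermiteGrad hZ m n (e j)) = c * inner ℂ (v i) (v j)) :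
    ∃ U : K →L[ℂ] Lp H 2 P, (∀ i, U (v i) = hermiteGrad hZ m n (e i)) ∧
      (∀ f, (T f, ((m + 1 : ℕ) : ℂ) • U f) ∈ (smoothGraph Z P).topologicalClosure) ∧
      ∀ f, ∀ q ∈ smoothGraph Z P, inner ℂ (T f) q.1 = inner ℂ (U f) q.2 := by
  -- `U` is normalized so that `δ U f = T f` while `D T f = (m+1) U f`; the eigenvalue `m + 1` of `δ
  -- D` is read off from this.
  obtain ⟨U, hU⟩ := hv.exists_clm (fun i => hermiteGrad hZ m n (e i)) hc hgram
  refine ⟨U, hU, hv.mem_closure_smoothGraph T (((m + 1 : ℕ) : ℂ) • U) fun i => ?_,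
    fun f q hq => hv.inner_eq_inner T U (fun i => ?_) f⟩
  · rw [hT, smul_apply, hU]
    exact hermiteVec_succ_mem_smoothGraph hZ m n (e i)
  · rw [hT, hU]
    exact inner_hermiteVec_succ hZ m n (e i) hq

variable [TopologicalSpace.SeparableSpace H] [IsProbabilityMeasure P]

theorem IsTotalFamily.malliavinD_zero (hv : IsTotalFamily v) (hZ : IsComplexIsonormal Z P)
    (hgen : SigmaAlgebraGeneratedBy Z P) {n : ℕ} {T : K →L[ℂ] Lp ℂ 2 P}
    (hT : ∀ i, T (v i) = hermiteVec hZ 0 n (e i)) (f : K) :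
    ∃ hF : T f ∈ (malliavinD Z P).domain, malliavinD Z P ⟨T f, hF⟩ = 0 :=
  hZ.exists_malliavinD_eq hgen <| hv.mem_closure_smoothGraph T 0 (fun i => by
    simpa [hT] using hermiteVec_zero_mem_smoothGraph hZ n (e i)) f

variable [CompleteSpace H]

theorem IsTotalFamily.ouL_zero (hv : IsTotalFamily v) (hZ : IsComplexIsonormal Z P)
    (hgen : SigmaAlgebraGeneratedBy Z P) {n : ℕ} {T : K →L[ℂ] Lp ℂ 2 P}
    (hT : ∀ i, T (v i) = hermiteVec hZ 0 n (e i)) (f : K) :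
    ∃ hF : T f ∈ (ouL Z P).domain, ouL Z P ⟨T f, hF⟩ = 0 :=
  hZ.exists_ouL_eq hgen (U := 0) (hv.mem_closure_smoothGraph T 0 (fun i => by
    simpa [hT] using hermiteVec_zero_mem_smoothGraph hZ n (e i)) f) fun q _ => by simp

theorem IsTotalFamily.malliavinD_succ (hv : IsTotalFamily v) (hZ : IsComplexIsonormal Z P)
    (hgen : SigmaAlgebraGeneratedBy Z P) {m n : ℕ} {T : K →L[ℂ] Lp ℂ 2 P}
    (hT : ∀ i, T (v i) = hermiteVec hZ (m + 1) n (e i))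
    {c : ℝ} (hc : 0 ≤ c) (hgram : ∀ i j, inner ℂ (hermiteGrad hZ m n (e i))
      (hermiteGrad hZ m n (e j)) = c * inner ℂ (v i) (v j))
    {S : H → K →L[ℂ] Lp ℂ 2 P}
    (hS : ∀ g i, S g (v i) = inner ℂ g (e i) • hermiteVec hZ m n (e i)) (f : K) :
    ∃ hF : T f ∈ (malliavinD Z P).domain, ∀ g : H, ∀ᵐ ω ∂P,
      inner ℂ g (malliavinD Z P ⟨T f, hF⟩ ω) = ((m + 1 : ℕ) : ℂ) * S g f ω := by
  obtain ⟨U, hU, hcl, -⟩ := hv.exists_gradient hZ hT hc hgram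
  obtain ⟨hF, hD⟩ := hZ.exists_malliavinD_eq hgen (hcl f)
  refine ⟨hF, fun g => ?_⟩
  -- Pairing the gradient with `g` and integrating the slice of the kernel are both bounded
  -- operators of `f`, so agreement on `v` suffices.
  have hSU : ((innerSL ℂ g).compLpL 2 P) ∘L U = S g := hv.clm_ext fun i => by
    rw [hS, ContinuousLinearMap.comp_apply, hU]
    refine Lp.ext ?_
    filter_upwards [(innerSL ℂ g).coeFn_compLpL (p := 2) (hermiteGrad hZ m n (e i)),
      coeFn_hermiteGrad hZ m n (e i), coeFn_hermiteVec hZ m n (e i),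
      Lp.coeFn_smul (inner ℂ g (e i)) (hermiteVec hZ m n (e i))] with ω h1 h2 h3 h4
    rw [h1, h2, h4, Pi.smul_apply, h3, innerSL_apply_apply, inner_smul_right, smul_eq_mul, mul_comm]
  rw [hD, ← hSU]
  filter_upwards [(innerSL ℂ g).coeFn_compLpL (p := 2) (U f),
    Lp.coeFn_smul ((m + 1 : ℕ) : ℂ) (U f)] with ω h1 h2
  rw [h2, ContinuousLinearMap.comp_apply, h1, Pi.smul_apply, inner_smul_right, innerSL_apply_apply]

theorem IsTotalFamily.ouL_succ (hv : IsTotalFamily v) (hZ : IsComplexIsonormal Z P)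
    (hgen : SigmaAlgebraGeneratedBy Z P) {m n : ℕ} {T : K →L[ℂ] Lp ℂ 2 P}
    (hT : ∀ i, T (v i) = hermiteVec hZ (m + 1) n (e i))
    {c : ℝ} (hc : 0 ≤ c) (hgram : ∀ i j, inner ℂ (hermiteGrad hZ m n (e i))
      (hermiteGrad hZ m n (e j)) = c * inner ℂ (v i) (v j)) (f : K) :
    ∃ hF : T f ∈ (ouL Z P).domain, ouL Z P ⟨T f, hF⟩ = ((m + 1 : ℕ) : ℂ) • T f := by
  obtain ⟨U, -, hcl, hadj⟩ := hv.exists_gradient hZ hT hc hgram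
  refine hZ.exists_ouL_eq hgen (hcl f) fun q hq => ?_
  rw [inner_smul_left, inner_smul_left, hadj f q hq]

end Chaos

/-! ### Wiener–Itô integrals as eigenvectors of the Ornstein–Uhlenbeck operators -/

section Main

variable {H : Type u} [NormedAddCommGroup H] [InnerProductSpace ℂ H]
  {Ω : Type v} [MeasurableSpace Ω] {P : Measure Ω} [IsProbabilityMeasure P] {Z : H → Ω → ℂ}
  {cj : H ≃ₗᵢ⋆[ℂ] H}

/-- Lets the chaos lemmas run for the conjugate process with `v = diagTensor cj m n` and `e = cj`;
this is why they keep the two families separate. -/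
lemma wienerIto_diagTensor_conjProcess (hZ : IsComplexIsonormal Z P)
    (hcj : ∀ h, cj (cj h) = h) (m n : ℕ) (h : H) :
    wienerIto cj Z P m n (diagTensor cj m n h) =
      hermiteVec (hZ.conjProcess cj) n m (cj h) := by
  rw [wienerIto_diagTensor hZ hcj, hermiteVec_conjProcess hZ hcj]

/-- The vector `h` in the gradient contributes the factor `⟪g, h⟫` that raises bidegree `(m, n)` to
`(m + 1, n)`; the constant remains `m! n!`. -/
lemma inner_hermiteGrad_eq_left (hZ : IsComplexIsonormal Z P) (hcj : ∀ h, cj (cj h) = h)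
    (m n : ℕ) (g h : H) :
    inner ℂ (hermiteGrad hZ m n g) (hermiteGrad hZ m n h) =
      ((m.factorial * n.factorial : ℝ) : ℂ) *
        inner ℂ (diagTensor cj (m + 1) n g) (diagTensor cj (m + 1) n h) := by
  rw [inner_hermiteGrad, inner_hermiteVec hZ hcj, inner_diagTensor, inner_diagTensor]
  push_cast
  ring

lemma inner_hermiteGrad_eq_right (hZ : IsComplexIsonormal Z P) (hcj : ∀ h, cj (cj h) = h)
    (m n : ℕ) (g h : H) :
    inner ℂ (hermiteGrad (hZ.conjProcess cj) n m (cj g))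
        (hermiteGrad (hZ.conjProcess cj) n m (cj h)) =
      ((m.factorial * n.factorial : ℝ) : ℂ) *
        inner ℂ (diagTensor cj m (n + 1) g) (diagTensor cj m (n + 1) h) := by
  rw [inner_hermiteGrad, hermiteVec_conjProcess hZ hcj, hermiteVec_conjProcess hZ hcj,
    inner_hermiteVec hZ hcj, inner_diagTensor, inner_diagTensor]
  push_cast
  ring

variable [CompleteSpace H] [TopologicalSpace.SeparableSpace H]

theorem ouL_wienerIto (hZ : IsComplexIsonormal Z P) (hcj : ∀ h, cj (cj h) = h)
    (hgen : SigmaAlgebraGeneratedBy Z P) (m n : ℕ) (f : KernelSp H m n) :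
    ∃ hF : wienerIto cj Z P m n f ∈ (ouL Z P).domain,
      ouL Z P ⟨wienerIto cj Z P m n f, hF⟩ = (m : ℂ) • wienerIto cj Z P m n f := by
  cases m with
  | zero =>
    rw [Nat.cast_zero, zero_smul]
    exact (isTotal_diagTensor cj 0 n).ouL_zero hZ hgen (wienerIto_diagTensor hZ hcj 0 n) f
  | succ m =>
    exact (isTotal_diagTensor cj (m + 1) n).ouL_succ hZ hgen
      (wienerIto_diagTensor hZ hcj (m + 1) n) (by positivity)
      (inner_hermiteGrad_eq_left hZ hcj m n) f

theorem ouLBar_wienerIto (hZ : IsComplexIsonormal Z P) (hcj : ∀ h, cj (cj h) = h)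
    (hgen : SigmaAlgebraGeneratedBy Z P) (m n : ℕ) (f : KernelSp H m n) :
    ∃ hF : wienerIto cj Z P m n f ∈ (ouLBar Z P cj).domain,
      ouLBar Z P cj ⟨wienerIto cj Z P m n f, hF⟩ = (n : ℂ) • wienerIto cj Z P m n f := by
  rw [ouLBar_eq hcj]
  cases n with
  | zero =>
    rw [Nat.cast_zero, zero_smul]
    exact (isTotal_diagTensor cj m 0).ouL_zero (hZ.conjProcess cj) (hgen.conjProcess hcj)
      (wienerIto_diagTensor_conjProcess hZ hcj m 0) f
  | succ n =>
    exact (isTotal_diagTensor cj m (n + 1)).ouL_succ (hZ.conjProcess cj) (hgen.conjProcess hcj)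
      (wienerIto_diagTensor_conjProcess hZ hcj m (n + 1)) (by positivity)
      (inner_hermiteGrad_eq_right hZ hcj m n) f

end Main

theorem proposition2p6 {H : Type*} [NormedAddCommGroup H] [InnerProductSpace ℂ H]
    [CompleteSpace H] [TopologicalSpace.SeparableSpace H]
    (cj : H ≃ₗᵢ⋆[ℂ] H) (hcj : ∀ h, cj (cj h) = h)
    {Ω : Type*} [MeasurableSpace Ω] (P : Measure Ω) [IsProbabilityMeasure P]
    (Z : H → Ω → ℂ) (hZ : IsComplexIsonormal Z P) (hgen : SigmaAlgebraGeneratedBy Z P) :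
    -- the Wiener–Itô integrals are well defined
    (∀ m n, ∃! T, IsWienerIto cj Z P m n T) ∧
    -- D I_{0,n}(f) = 0 and D I_{m+1,n}(f) = (m+1) I_{m,n}(f)
    (∀ (n : ℕ) (f : KernelSp H 0 n),
      ∃ hF : wienerIto cj Z P 0 n f ∈ (malliavinD Z P).domain,
        malliavinD Z P ⟨wienerIto cj Z P 0 n f, hF⟩ = 0) ∧
    (∀ (m n : ℕ) (f : KernelSp H (m + 1) n),
      ∃ hF : wienerIto cj Z P (m + 1) n f ∈ (malliavinD Z P).domain,
        ∀ g : H, ∀ᵐ ω ∂P,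
          inner ℂ g (malliavinD Z P ⟨wienerIto cj Z P (m + 1) n f, hF⟩ ω) =
            ((m + 1 : ℕ) : ℂ) * wienerIto cj Z P m n (sliceLeft m n g f) ω) ∧
    -- D̄ I_{m,0}(f) = 0 and D̄ I_{m,n+1}(f) = (n+1) I_{m,n}(f)
    (∀ (m : ℕ) (f : KernelSp H m 0),
      ∃ hF : wienerIto cj Z P m 0 f ∈ (malliavinDBar Z P cj).domain,
        malliavinDBar Z P cj ⟨wienerIto cj Z P m 0 f, hF⟩ = 0) ∧
    (∀ (m n : ℕ) (f : KernelSp H m (n + 1)),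
      ∃ hF : wienerIto cj Z P m (n + 1) f ∈ (malliavinDBar Z P cj).domain,
        ∀ g : H, ∀ᵐ ω ∂P,
          inner ℂ g (malliavinDBar Z P cj ⟨wienerIto cj Z P m (n + 1) f, hF⟩ ω) =
            ((n + 1 : ℕ) : ℂ) * wienerIto cj Z P m n (sliceRight m n g f) ω) ∧
    -- L I_{m,n}(f) = m I_{m,n}(f) and L̄ I_{m,n}(f) = n I_{m,n}(f)
    (∀ (m n : ℕ) (f : KernelSp H m n),
      ∃ hF : wienerIto cj Z P m n f ∈ (ouL Z P).domain,
        ouL Z P ⟨wienerIto cj Z P m n f, hF⟩ = (m : ℂ) • wienerIto cj Z P m n f) ∧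
    (∀ (m n : ℕ) (f : KernelSp H m n),
      ∃ hF : wienerIto cj Z P m n f ∈ (ouLBar Z P cj).domain,
        ouLBar Z P cj ⟨wienerIto cj Z P m n f, hF⟩ = (n : ℂ) • wienerIto cj Z P m n f) := by
  have hZ' := hZ.conjProcess cj
  have hgen' := hgen.conjProcess hcj
  have hfac : ∀ m n : ℕ, (0 : ℝ) ≤ m.factorial * n.factorial := fun m n => by positivity
  rw [malliavinDBar_eq hcj]
  refine ⟨existsUnique_isWienerIto hZ hcj, fun n f => ?_, fun m n f => ?_, fun m f => ?_,
    fun m n f => ?_, ouL_wienerIto hZ hcj hgen, ouLBar_wienerIto hZ hcj hgen⟩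
  · exact (isTotal_diagTensor cj 0 n).malliavinD_zero hZ hgen (wienerIto_diagTensor hZ hcj 0 n) f
  · refine (isTotal_diagTensor cj (m + 1) n).malliavinD_succ hZ hgen
      (wienerIto_diagTensor hZ hcj (m + 1) n) (hfac m n) (inner_hermiteGrad_eq_left hZ hcj m n)
      (S := fun g => wienerIto cj Z P m n ∘L sliceLeft m n g) (fun g h => ?_) f
    rw [ContinuousLinearMap.comp_apply, sliceLeft_diagTensor, map_smul,
      wienerIto_diagTensor hZ hcj]
  · exact (isTotal_diagTensor cj m 0).malliavinD_zero hZ' hgen'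
      (wienerIto_diagTensor_conjProcess hZ hcj m 0) f
  · refine (isTotal_diagTensor cj m (n + 1)).malliavinD_succ hZ' hgen'
      (wienerIto_diagTensor_conjProcess hZ hcj m (n + 1)) (hfac m n)
      (inner_hermiteGrad_eq_right hZ hcj m n)
      (S := fun g => wienerIto cj Z P m n ∘L sliceRight m n g) (fun g h => ?_) f
    rw [ContinuousLinearMap.comp_apply, sliceRight_diagTensor, map_smul,
      wienerIto_diagTensor_conjProcess hZ hcj]
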